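/- For a weight $w:\mathbb R\to[0,\infty)$ let $\mathrm{OE}_n(w)$ and $\mathrm{UE}_n(w)$ be the eigenvalue distributions on $\mathbb R^n$ with probability density proportional to $\prod_i w(x_i)\prod_{i<j}|x_j-x_i|$ and $\prod_i w(x_i)\prod_{i<j}(x_j-x_i)^2$, respectively. Let $M\cup N$ denote the superposition of two independent ensembles, and let $\mathrm{even}(M)$ denote the ensemble formed by the 2nd largest, 4th largest, … eigenvalues of $M$. **Theorem.** Fix $n\ge 2$. Let $f:\mathbb R\to[0,\infty)$ be differentiable on a possibly unbounded open interval $I\subset\mathbb R$ and $0$ elsewhere, such that $\mathrm{OE}_n(f)$ is a well-defined probability distribution (the normalizing integral is positive and finite). Suppose that $\mathrm{even}(\mathrm{OE}_n(f)\cup \mathrm{OE}_n(f))=\mathrm{UE}_n(g)$ (equality of the laws of the ordered eigenvalues) for some measurable $g:\mathbb R\to[0,\infty)$. Let $J=\{x: f(x)>0\}\subset I$ (so $J=I$ if $f$ is positive on $I$). Then $J\neq\mathbb R$, and there is an order-preserving affine change of variables (the same for $f$, $g$ and $J$) after which $J$ is an open interval $K$ and $f$ and $g$, which vanish off $K$ ($g$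 almost everywhere), have one of the following forms on $K$, where $\propto$ means equality up to a positive constant factor, and the relations for $g$ hold almost everywhere. Either $K$ is an open interval with right endpoint $0$ and possibly infinite left endpoint, and 1. $f(x)\propto(-x)^{\alpha}(1-rx)^{-n-1-\alpha}$ and $g(x)\propto(-x)^{2\alpha+1}(1-rx)^{-2n-1-2\alpha}$ for some real $\alpha>-1$ and $r$ with $1\notin rK$; or 2. $f(x)\propto(-x)^{-n-1}e^{1/x}$ and $g(x)\propto(-x)^{-2n}e^{2/x}$; or $K=(a,\infty)$ for some real $a$, and 3. $f(x)\propto(1-rx)^{\alpha}$ and $g(x)\propto(1-rx)^{2\alpha+1}$ for some real $\alpha<-n$ and $r<0$, with $1-rx>0$ on $K$; or 4. $f(x)\propto e^{-x}$ and $g(x)\propto e^{-2x}$. -/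

import Mathlib

open MeasureTheory

namespace Decimation

/-- The Vandermonde product `Δ(x) = ∏_{i < j} (x_j - x_i)`. -/
noncomputable def vdm {n : ℕ} (x : Fin n → ℝ) : ℝ :=
  ∏ i, ∏ j ∈ Finset.Ioi i, (x j - x i)

/-- The measure on `ℝⁿ` with (not yet normalized) density `∏ w(x_i) · |Δ(x)|^β`. -/
noncomputable def weightMeasure (β n : ℕ) (w : ℝ → ℝ) : Measure (Fin n → ℝ) :=
  volume.withDensity fun x => ENNReal.ofReal ((∏ i, w (x i)) * |vdm x| ^ β)

/-- The eigenvalue distribution with density proportional to `∏ w(x_i) · |Δ(x)|^β`.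
It is a probability measure exactly when the total mass of the unnormalized measure is neither
`0` nor `∞`; otherwise it is the zero measure. -/
noncomputable def ensemble (β n : ℕ) (w : ℝ → ℝ) : Measure (Fin n → ℝ) :=
  (weightMeasure β n w Set.univ)⁻¹ • weightMeasure β n w

/-- The orthogonal ensemble: density proportional to `∏ w(x_i) · |Δ(x)|`. -/
noncomputable def OE (n : ℕ) (w : ℝ → ℝ) : Measure (Fin n → ℝ) := ensemble 1 n w

/-- The unitary ensemble: density proportional to `∏ w(x_i) · Δ(x)²`. -/
noncomputable def UE (n : ℕ) (w : ℝ → ℝ) : Measure (Fin n → ℝ) := ensemble 2 n w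

/-- The random superposition `M ∪ N` of two independent ensembles. -/
noncomputable def superpose {m n : ℕ} (M : Measure (Fin m → ℝ)) (N : Measure (Fin n → ℝ)) :
    Measure (Fin (m + n) → ℝ) :=
  (M.prod N).map fun p => Fin.append p.1 p.2

/-- The coordinates of `x` listed in decreasing order: `decr x i` is the `(i+1)`-st largest. -/
noncomputable def decr {m : ℕ} (x : Fin m → ℝ) (i : Fin m) : ℝ := x (Tuple.sort x i.rev)

/-- The 2nd largest, 4th largest, ..., `2n`-th largest of `2n` numbers, in decreasing order. -/
noncomputable def evenPart {n : ℕ} (x : Fin (n + n) → ℝ) (i : Fin n) : ℝ :=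
  decr x ⟨2 * i.1 + 1, by omega⟩

/-- The law of the eigenvalues of an ensemble, listed in decreasing order. -/
noncomputable def orderedLaw {n : ℕ} (M : Measure (Fin n → ℝ)) : Measure (Fin n → ℝ) :=
  M.map decr

/-- The law of `even(M)`, with the eigenvalues listed in decreasing order. -/
noncomputable def evenLaw {n : ℕ} (M : Measure (Fin (n + n) → ℝ)) : Measure (Fin n → ℝ) :=
  M.map evenPart

/-- After the order-preserving affine change of variables `y = s x + t`, the weights `f` and `g`
are proportional to `F` and `G` on the interval `K` and vanish off `K`. As a weight `g` matters
only up to null sets, the second relation is an almost everywhere one. -/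
def HaveForm (f g : ℝ → ℝ) (s t : ℝ) (K : Set ℝ) (F G : ℝ → ℝ) : Prop :=
  (∃ c : ℝ, 0 < c ∧ ∀ x, f (s * x + t) = c * K.indicator F x) ∧
  (∃ d : ℝ, 0 < d ∧ ∀ᵐ x : ℝ, g (s * x + t) = d * K.indicator G x)

/-! The maps used in the push-forwards are measurable. -/

theorem measurable_decr {m : ℕ} : Measurable (decr : (Fin m → ℝ) → Fin m → ℝ) := by
  classical
  refine measurable_pi_lambda _ fun i => ?_
  have hset : ∀ σ : Equiv.Perm (Fin m), MeasurableSet {x : Fin m → ℝ | σ = Tuple.sort x} := by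
    intro σ
    simp only [Tuple.eq_sort_iff, Monotone, Function.comp]
    have hle : ∀ a b : Fin m, MeasurableSet {x : Fin m → ℝ | x a ≤ x b} := fun a b =>
      measurableSet_le (measurable_pi_apply a) (measurable_pi_apply b)
    have heq : ∀ a b : Fin m, MeasurableSet {x : Fin m → ℝ | x a = x b} := fun a b =>
      measurableSet_eq_fun (measurable_pi_apply a) (measurable_pi_apply b)
    simp only [measurableSet_setOfPred] at hle heq ⊢
    refine Measurable.and (Measurable.forall fun a => Measurable.forall fun b =>
      Measurable.imp measurable_const (hle _ _)) (Measurable.forall fun a =>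
      Measurable.forall fun b => Measurable.imp measurable_const
        (Measurable.imp (heq _ _) measurable_const))
  have hsum : (fun x : Fin m → ℝ => decr x i) =
      fun x => ∑ σ : Equiv.Perm (Fin m), if σ = Tuple.sort x then x (σ i.rev) else 0 := by
    funext x
    simp [decr]
  rw [hsum]
  exact Finset.measurable_sum _ fun σ _ =>
    Measurable.ite (hset σ) (measurable_pi_apply _) measurable_const

theorem measurable_evenPart {n : ℕ} :
    Measurable (evenPart : (Fin (n + n) → ℝ) → Fin n → ℝ) :=
  measurable_pi_lambda _ fun _ => (measurable_pi_apply _).comp measurable_decr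

theorem measurable_append {m n : ℕ} :
    Measurable fun p : (Fin m → ℝ) × (Fin n → ℝ) => Fin.append p.1 p.2 := by
  refine measurable_pi_lambda _ fun i => ?_
  refine Fin.addCases (fun j => ?_) (fun j => ?_) i
  · simpa using measurable_pi_iff.1 measurable_fst j
  · simpa using measurable_pi_iff.1 measurable_snd j

end Decimation

/-!
The law of `even(OE_n(f) ∪ OE_n(f))` has an explicit density. For a decreasing list of `2n` numbers,
the sum of `|Δ(S)| |Δ(Sᶜ)|` over all ways to split it into two halves is a constant times the product
of the Vandermonde products of the odd-ranked and of the even-ranked entries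
(`sum_abs_vdm_mul_abs_vdm`). Integrating out the odd-ranked entries, which interlace with the
even-ranked ones `y`, gives the determinant of the tail moments `F_k(y_j) = ∫_{y_j}^∞ z^k f(z) dz`
(`lintegral_interlace`). Hence equality of the laws says that, for almost every `y`,
`C ∏ f(y_j) det[F_k(y_j)] = ∏ g(y_j) Δ(y)` (`exists_det_tailMatrix_eq`).

Freezing all but one variable at a generic base point and applying Cramer's rule, this becomes a
statement in one variable: there is a bijection `q ↦ p` of the polynomials of degree `< n` with
`f(y) ∫_y^∞ q f = g(y) p(y)` (`tail_relation`). Let `H = ∫_y^∞ q₀ f` be the tail integral that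
corresponds to `p = 1`. Then `g = f H` almost everywhere, and on `J = {f > 0}` the tail integral
corresponding to `p = y^j` is `H y^j`. Differentiating these identities shows that `H = R f` and
`H' = -q₀ f` on `J`, with `R` a polynomial, and that `y^{j-1} (y q₀ - j R)` has degree `< n` for
all `j < n`. This forces `deg R ≤ 2`, `deg q₀ ≤ 1`, and the coefficient of `y` in `q₀` to be `n - 1`
times that of `y²` in `R` (`coeff_of_tail_recursion`). In particular `H'/H = -q₀/R`, a Pearson
equation. At a boundary point of a component of `J` other than `sup J`, one would have `R f = 0`
while `H ≠ 0`; so `J` is an interval (`exists_pearsonPair`).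

It remains to solve the Pearson equation. Tail integrals vanish at the right endpoint of `J`. If that
endpoint `b` is finite, `H(b) = 0` forces `R(b) = 0`, and a simple or a double root of `R` at `b`
gives the first or the second form. If it is infinite, `H y^{n-1} → 0` rules out `deg R = 2`; a
linear or a constant `R` gives the third or the fourth form.
-/

namespace Decimation

open scoped ENNReal
open Filter Topology

/-! ### The Vandermonde product and the summation identity over superpositions -/

theorem vdm_eq_det {n : ℕ} (x : Fin n → ℝ) : vdm x = (Matrix.vandermonde x).det :=
  (Matrix.det_vandermonde x).symm

theorem vdm_comp_perm {n : ℕ} (x : Fin n → ℝ) (σ : Equiv.Perm (Fin n)) :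
    vdm (x ∘ σ) = (Equiv.Perm.sign σ : ℤ) * vdm x := by
  rw [vdm_eq_det, vdm_eq_det, ← Matrix.det_permute]
  rfl

theorem vdm_ne_zero {n : ℕ} {x : Fin n → ℝ} (hx : Function.Injective x) : vdm x ≠ 0 := by
  rw [vdm_eq_det]
  exact Matrix.det_vandermonde_ne_zero_iff.2 hx

theorem vdm_eq_prod_ite {n : ℕ} (x : Fin n → ℝ) :
    vdm x = ∏ i, ∏ j, if i < j then x j - x i else 1 := by
  refine Finset.prod_congr rfl fun i _ => ?_
  rw [← Finset.prod_filter]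
  congr 1
  ext j
  simp

theorem vdm_split {m n : ℕ} (w : Fin (m + n) → ℝ) :
    vdm w = vdm (fun i => w (Fin.castAdd n i)) * vdm (fun j => w (Fin.natAdd m j)) *
      ∏ i, ∏ j, (w (Fin.natAdd m j) - w (Fin.castAdd n i)) := by
  have hlt : ∀ (i : Fin m) (j : Fin n), Fin.castAdd n i < Fin.natAdd m j := fun i j => by
    rw [Fin.lt_def]; simp; omega
  have hcast : ∀ i j : Fin m, Fin.castAdd n i < Fin.castAdd n j ↔ i < j := fun i j => Iff.rfl
  have hnlt : ∀ (i : Fin m) (j : Fin n), ¬ Fin.natAdd m j < Fin.castAdd n i := fun i j =>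
    not_lt.2 (hlt i j).le
  simp only [vdm_eq_prod_ite, Fin.prod_univ_add, hlt, hnlt, if_true, if_false,
    Finset.prod_const_one, Finset.prod_mul_distrib, hcast, Fin.natAdd_lt_natAdd_iff]
  ring

theorem prod_offDiag_eq_vdm_sq {n : ℕ} (x : Fin n → ℝ) :
    ∏ i, ∏ j, (if j = i then 1 else x i - x j) =
      (∏ i : Fin n, ∏ _j ∈ Finset.Ioi i, (-1 : ℝ)) * vdm x ^ 2 := by
  have h := Finset.prod_prod_Ioi_mul_eq_prod_prod_off_diag (fun i j : Fin n => x j - x i)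
  have h1 : ∀ i : Fin n, ∏ j, (if j = i then 1 else x i - x j) =
      ∏ j ∈ {i}ᶜ, (x i - x j) := by
    intro i
    rw [← Finset.prod_compl_mul_prod {i}]
    simp only [Finset.prod_singleton, if_true, mul_one]
    exact Finset.prod_congr rfl fun j hj => if_neg (by simpa using hj)
  simp only [h1, ← h, vdm, ← Finset.prod_pow, ← Finset.prod_mul_distrib]
  refine Finset.prod_congr rfl fun i _ => Finset.prod_congr rfl fun j _ => ?_
  ring

/-- In a decreasing list, the product of the differences of the `l`-th entry with the others has
the sign `(-1) ^ l`. -/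
theorem alternating_prod_pos {m : ℕ} {w : Fin m → ℝ} (hw : StrictAnti w) (l : Fin m) :
    0 < (-1 : ℝ) ^ (l : ℕ) * ∏ k, (if k = l then 1 else w l - w k) := by
  have h1 : (-1 : ℝ) ^ (l : ℕ) = ∏ k, (if k < l then (-1 : ℝ) else 1) := by
    rw [← Finset.prod_filter, Finset.prod_const]
    congr 1
    have : (Finset.univ.filter fun k : Fin m => k < l) = Finset.Iio l := by ext; simp
    rw [this, Fin.card_Iio]
  rw [h1, ← Finset.prod_mul_distrib]
  refine Finset.prod_pos fun k _ => ?_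
  rcases lt_trichotomy k l with h | h | h
  · have := hw h
    simp [h, h.ne]; linarith
  · simp [h]
  · have := hw h
    simp [h.not_gt, h.ne']; linarith

/-- For a decreasing list split in two blocks by a permutation, the sign of the product of the two
Vandermonde products is, up to a global sign, the sign of the permutation times the product of the
parities of the positions of the first block. Indeed the Vandermonde product of the whole permuted
list is that of the two blocks times the product `C` of the cross differences, and the sign of `C` is
found by comparing it with `alternating_prod_pos` over the first block. -/
theorem exists_sign_abs_vdm_mul {n : ℕ} {w : Fin (n + n) → ℝ} (hw : StrictAnti w) :
    ∃ κ : ℝ, |κ| = 1 ∧ ∀ σ : Equiv.Perm (Fin (n + n)),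
      |vdm fun i => w (σ (Fin.castAdd n i))| * |vdm fun i => w (σ (Fin.natAdd n i))| =
      κ * ((Equiv.Perm.sign σ : ℤ) * (∏ i : Fin n, (-1 : ℝ) ^ (σ (Fin.castAdd n i) : ℕ)) *
        ((vdm fun i => w (σ (Fin.castAdd n i))) * vdm fun i => w (σ (Fin.natAdd n i)))) := by
  set ν : ℝ := (∏ i : Fin n, ∏ _j ∈ Finset.Ioi i, (-1 : ℝ)) *
    ∏ _i : Fin n, ∏ _j : Fin n, (-1 : ℝ) with hν
  have hνabs : |ν| = 1 := by
    simp only [hν, abs_mul, Finset.abs_prod, abs_neg, abs_one, Finset.prod_const_one, mul_one]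
  have hv : vdm w ≠ 0 := vdm_ne_zero hw.injective
  refine ⟨ν * (|vdm w| / vdm w), ?_, fun σ => ?_⟩
  · rw [abs_mul, hνabs, one_mul, abs_div, abs_abs, div_self (abs_ne_zero.2 hv)]
  set s : ℝ := ∏ i : Fin n, (-1 : ℝ) ^ (σ (Fin.castAdd n i) : ℕ) with hs
  set X := vdm fun i => w (σ (Fin.castAdd n i)) with hX
  set Y := vdm fun i => w (σ (Fin.natAdd n i)) with hY
  set C := ∏ i : Fin n, ∏ j : Fin n, (w (σ (Fin.natAdd n j)) - w (σ (Fin.castAdd n i))) with hC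
  set ε : ℝ := ((Equiv.Perm.sign σ : ℤ) : ℝ) with hε
  have hεabs : |ε| = 1 := by
    rw [hε]; rcases Int.units_eq_one_or (Equiv.Perm.sign σ) with h | h <;> simp [h]
  have hsabs : |s| = 1 := by simp [hs, Finset.abs_prod]
  have hs2 : s * s = 1 := by rw [← abs_mul_abs_self, hsabs, one_mul]
  have hε2 : ε * ε = 1 := by rw [← abs_mul_abs_self, hεabs, one_mul]
  have e1 : ε * vdm w = X * Y * C := by
    rw [hε, ← vdm_comp_perm, vdm_split]; rfl
  have e2 : 0 < s * (ν * X ^ 2 * C) := by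
    have := Finset.prod_pos (s := (Finset.univ : Finset (Fin n))) fun i _ =>
      alternating_prod_pos hw (σ (Fin.castAdd n i))
    rw [Finset.prod_mul_distrib, ← hs] at this
    refine this.trans_eq (congrArg (s * ·) ?_)
    have h3 : ∀ i : Fin n, (∏ k, if k = σ (Fin.castAdd n i) then 1 else
        w (σ (Fin.castAdd n i)) - w k) =
        (∏ j, if j = i then 1 else w (σ (Fin.castAdd n i)) - w (σ (Fin.castAdd n j))) *
        ((∏ _j : Fin n, (-1)) *
          ∏ j, (w (σ (Fin.natAdd n j)) - w (σ (Fin.castAdd n i)))) := by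
      intro i
      rw [← Equiv.prod_comp σ, Fin.prod_univ_add]
      have hne : ∀ j : Fin n, Fin.natAdd n j ≠ Fin.castAdd n i := fun j h => by
        have := congrArg Fin.val h
        simp at this; omega
      simp only [σ.injective.eq_iff, hne, if_false, Fin.castAdd_inj]
      congr 1
      rw [← Finset.prod_mul_distrib]
      exact Finset.prod_congr rfl fun j _ => by ring
    rw [Finset.prod_congr rfl fun i _ => h3 i, Finset.prod_mul_distrib, Finset.prod_mul_distrib,
      prod_offDiag_eq_vdm_sq fun i => w (σ (Fin.castAdd n i)), ← hX, ← hC, hν]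
    ring
  have hX0 : 0 < X ^ 2 := by
    refine lt_of_le_of_ne (sq_nonneg _) fun h => ?_
    rw [← h] at e2; simp at e2
  have e3 : 0 < s * ν * C := by
    have : 0 < X ^ 2 * (s * ν * C) := by linarith [e2, show s * (ν * X ^ 2 * C) = X ^ 2 * (s * ν * C) by ring]
    exact pos_of_mul_pos_right this hX0.le
  have e4 : (ε * s * (X * Y)) * (s * ν * C) = ν * vdm w := by
    calc _ = (s * s) * ν * ε * (X * Y * C) := by ring
      _ = (s * s) * ν * (ε * ε) * vdm w := by rw [← e1]; ring
      _ = _ := by rw [hs2, hε2]; ring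
  have hν2 : ν * ν = 1 := by rw [← abs_mul_abs_self, hνabs, one_mul]
  have e5 : 0 ≤ ν * (|vdm w| / vdm w) * (ε * s * (X * Y)) := by
    have : ν * (|vdm w| / vdm w) * (ε * s * (X * Y)) * (s * ν * C) = |vdm w| := by
      calc _ = ν * (|vdm w| / vdm w) * ((ε * s * (X * Y)) * (s * ν * C)) := by ring
        _ = (ν * ν) * (|vdm w| / vdm w * vdm w) := by rw [e4]; ring
        _ = _ := by rw [hν2, div_mul_cancel₀ _ hv, one_mul]
    exact le_of_lt (pos_of_mul_pos_left (by rw [this]; exact abs_pos.2 hv) e3.le)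
  rw [← abs_of_nonneg e5]
  simp only [abs_mul, abs_div, abs_abs, hνabs, hεabs, hsabs, div_self (abs_ne_zero.2 hv), one_mul]

/-- Expanding the two Vandermonde determinants and absorbing their permutations into the outer
sum leaves a single `2n × 2n` determinant. -/
theorem sum_sign_mul_vdm_mul_vdm {n : ℕ} (u w : Fin (n + n) → ℝ) :
    ∑ σ : Equiv.Perm (Fin (n + n)), (Equiv.Perm.sign σ : ℤ) *
        (∏ i : Fin n, u (σ (Fin.castAdd n i))) *
        ((vdm fun i => w (σ (Fin.castAdd n i))) * vdm fun i => w (σ (Fin.natAdd n i))) =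
      (n.factorial : ℝ) ^ 2 * (Matrix.of fun l c : Fin (n + n) =>
        Fin.addCases (fun k : Fin n => u l * w l ^ (k : ℕ))
          (fun k : Fin n => w l ^ (k : ℕ)) c).det := by
  set h : Equiv.Perm (Fin (n + n)) → ℝ := fun σ => (Equiv.Perm.sign σ : ℤ) *
    ((∏ i : Fin n, u (σ (Fin.castAdd n i)) * w (σ (Fin.castAdd n i)) ^ (i : ℕ)) *
      ∏ i : Fin n, w (σ (Fin.natAdd n i)) ^ (i : ℕ)) with hh
  have hdet : (Matrix.of fun l c : Fin (n + n) =>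
        Fin.addCases (fun k : Fin n => u l * w l ^ (k : ℕ))
          (fun k : Fin n => w l ^ (k : ℕ)) c).det = ∑ σ, h σ := by
    rw [Matrix.det_apply']
    refine Finset.sum_congr rfl fun σ _ => ?_
    simp [hh, Fin.prod_univ_add, -Fin.natAdd_eq_addNat]
  let P : Equiv.Perm (Fin n) × Equiv.Perm (Fin n) → Equiv.Perm (Fin (n + n)) := fun τ =>
    finSumFinEquiv.permCongr (Equiv.Perm.sumCongr τ.1 τ.2)
  have hPl : ∀ τ i, P τ (Fin.castAdd n i) = Fin.castAdd n (τ.1 i) := fun τ i => by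
    simp [P, Equiv.permCongr_apply]
  have hPr : ∀ τ i, P τ (Fin.natAdd n i) = Fin.natAdd n (τ.2 i) := fun τ i => by
    simp [P, Equiv.permCongr_apply, -Fin.natAdd_eq_addNat]
  have hterm : ∀ σ : Equiv.Perm (Fin (n + n)), (Equiv.Perm.sign σ : ℤ) *
        (∏ i : Fin n, u (σ (Fin.castAdd n i))) *
        ((vdm fun i => w (σ (Fin.castAdd n i))) * vdm fun i => w (σ (Fin.natAdd n i))) =
      ∑ τ : Equiv.Perm (Fin n) × Equiv.Perm (Fin n), h (σ * P τ) := by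
    intro σ
    rw [vdm_eq_det, vdm_eq_det, Matrix.det_apply', Matrix.det_apply', Finset.sum_mul_sum,
      Finset.mul_sum, Fintype.sum_prod_type]
    refine Finset.sum_congr rfl fun τ _ => ?_
    rw [Finset.mul_sum]
    refine Finset.sum_congr rfl fun τ' _ => ?_
    have hsgn : Equiv.Perm.sign (σ * P (τ, τ')) =
        Equiv.Perm.sign σ * (Equiv.Perm.sign τ * Equiv.Perm.sign τ') := by
      rw [map_mul, Equiv.Perm.sign_permCongr, Equiv.Perm.sign_sumCongr]
    simp only [hh, hsgn, Equiv.Perm.mul_apply, hPl, hPr, Finset.prod_mul_distrib,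
      Matrix.vandermonde_apply]
    rw [Equiv.prod_comp τ fun i => u (σ (Fin.castAdd n i))]
    push_cast
    ring
  rw [Finset.sum_congr rfl fun σ _ => hterm σ, Finset.sum_comm, hdet]
  have : ∀ τ, ∑ σ, h (σ * P τ) = ∑ σ, h σ := fun τ => Equiv.sum_comp (Equiv.mulRight (P τ)) h
  simp only [this, Finset.sum_const, Finset.card_univ, Fintype.card_prod, Fintype.card_perm,
    Fintype.card_fin, nsmul_eq_mul]
  push_cast
  ring

/-- The parity splitting of `2n` positions: `inl i` is the position `2i` (the odd-ranked entries),
`inr i` is the position `2i + 1` (the even-ranked ones). -/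
def parityEquiv (n : ℕ) : Fin n ⊕ Fin n ≃ Fin (n + n) where
  toFun := Sum.elim (fun i => ⟨2 * i.1, by omega⟩) (fun i => ⟨2 * i.1 + 1, by omega⟩)
  invFun l := if l.1 % 2 = 0 then Sum.inl ⟨l.1 / 2, by omega⟩ else Sum.inr ⟨l.1 / 2, by omega⟩
  left_inv := by
    rintro (i | i)
    · simp
    · have h : (2 * i.1 + 1) % 2 = 1 := by omega
      have h2 : (2 * i.1 + 1) / 2 = i.1 := by omega
      simp [h, h2]
  right_inv := by
    intro l
    by_cases h : l.1 % 2 = 0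
    · simp only [h, if_true, Sum.elim_inl]; ext; simp; omega
    · simp only [h, if_false, Sum.elim_inr]; ext; simp; omega

theorem parityEquiv_inl {n : ℕ} (i : Fin n) :
    ((parityEquiv n (Sum.inl i)) : ℕ) = 2 * i := rfl

theorem parityEquiv_inr {n : ℕ} (i : Fin n) :
    ((parityEquiv n (Sum.inr i)) : ℕ) = 2 * i + 1 := rfl

theorem abs_det_alternating_eq {n : ℕ} (w : Fin (n + n) → ℝ) :
    |(Matrix.of fun l c : Fin (n + n) =>
        Fin.addCases (fun k : Fin n => (-1 : ℝ) ^ (l : ℕ) * w l ^ (k : ℕ))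
          (fun k : Fin n => w l ^ (k : ℕ)) c).det| =
      2 ^ n * (|vdm fun i => w (parityEquiv n (Sum.inl i))| *
        |vdm fun i => w (parityEquiv n (Sum.inr i))|) := by
  rw [← Matrix.abs_det_submatrix_equiv_equiv (parityEquiv n) finSumFinEquiv]
  set A := Matrix.vandermonde fun i => w (parityEquiv n (Sum.inl i)) with hA
  set B := Matrix.vandermonde fun i => w (parityEquiv n (Sum.inr i)) with hB
  have h1 : (Matrix.of fun l c : Fin (n + n) =>
        Fin.addCases (fun k : Fin n => (-1 : ℝ) ^ (l : ℕ) * w l ^ (k : ℕ))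
          (fun k : Fin n => w l ^ (k : ℕ)) c).submatrix (parityEquiv n) finSumFinEquiv =
      Matrix.fromBlocks A A (-B) B := by
    ext r c
    rcases r with i | i <;> rcases c with k | k <;>
      simp [hA, hB, Matrix.vandermonde_apply, parityEquiv_inl, parityEquiv_inr, pow_add, pow_mul,
        -Fin.natAdd_eq_addNat]
  -- adding the second block of columns to the first makes the matrix block triangular
  have h2 : Matrix.fromBlocks A A (-B) B * Matrix.fromBlocks 1 0 1 1 =
      Matrix.fromBlocks ((2 : ℝ) • A) A 0 B := by
    rw [Matrix.fromBlocks_multiply]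
    simp [two_smul]
  have h3 := congrArg Matrix.det h2
  rw [Matrix.det_mul, Matrix.det_fromBlocks_zero₁₂, Matrix.det_fromBlocks_zero₂₁,
    Matrix.det_smul] at h3
  simp only [Matrix.det_one, mul_one, Fintype.card_fin] at h3
  rw [h1, h3, vdm_eq_det, vdm_eq_det, abs_mul, abs_mul, abs_pow, abs_two, mul_assoc]

/-- Summing `|Δ(S)| |Δ(Sᶜ)|` over all ways to distribute a decreasing list into two blocks of
equal size gives a constant times the product of the Vandermonde products of the odd-ranked and
of the even-ranked entries. -/
theorem sum_abs_vdm_mul_abs_vdm {n : ℕ} {w : Fin (n + n) → ℝ} (hw : StrictAnti w) :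
    ∑ σ : Equiv.Perm (Fin (n + n)),
      |vdm fun i => w (σ (Fin.castAdd n i))| * |vdm fun i => w (σ (Fin.natAdd n i))| =
      (n.factorial : ℝ) ^ 2 * 2 ^ n * (|vdm fun i => w (parityEquiv n (Sum.inl i))| *
        |vdm fun i => w (parityEquiv n (Sum.inr i))|) := by
  obtain ⟨κ, hκ, h⟩ := exists_sign_abs_vdm_mul hw
  have h0 : 0 ≤ ∑ σ : Equiv.Perm (Fin (n + n)),
      |vdm fun i => w (σ (Fin.castAdd n i))| * |vdm fun i => w (σ (Fin.natAdd n i))| :=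
    Finset.sum_nonneg fun σ _ => by positivity
  rw [← abs_of_nonneg h0, Finset.sum_congr rfl fun σ _ => h σ, ← Finset.mul_sum, abs_mul, hκ,
    one_mul, sum_sign_mul_vdm_mul_vdm (fun l => (-1 : ℝ) ^ (l : ℕ)) w, abs_mul,
    abs_det_alternating_eq, abs_of_nonneg (by positivity : (0 : ℝ) ≤ (n.factorial : ℝ) ^ 2)]
  ring

/-! ### Changes of variables for Lebesgue measure on coordinate spaces -/

theorem measurePreserving_comp_equiv {ι κ : Type*} [Fintype ι] [Fintype κ] (e : ι ≃ κ) :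
    MeasurePreserving (fun x : κ → ℝ => x ∘ e) volume volume := by
  have := volume_measurePreserving_piCongrLeft (fun _ : ι => ℝ) e.symm
  convert this using 1
  funext x i
  have h := Equiv.piCongrLeft_apply_apply (fun _ : ι => ℝ) e.symm x (e i)
  rw [Equiv.symm_apply_apply] at h
  exact h.symm

theorem measurePreserving_sumElim_comp_symm {ι κ γ : Type*} [Fintype ι] [Fintype κ] [Fintype γ]
    (e : ι ⊕ κ ≃ γ) :
    MeasurePreserving (fun p : (ι → ℝ) × (κ → ℝ) => Sum.elim p.1 p.2 ∘ e.symm) volume volume := by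
  have h := volume_measurePreserving_sumPiEquivProdPi_symm (fun _ : ι ⊕ κ => ℝ)
  have h2 := (measurePreserving_comp_equiv e.symm).comp h
  convert h2 using 1
  funext p l
  simp only [Function.comp, MeasurableEquiv.coe_sumPiEquivProdPi_symm]
  cases e.symm l <;> rfl

theorem measurePreserving_append (m n : ℕ) :
    MeasurePreserving (fun p : (Fin m → ℝ) × (Fin n → ℝ) => Fin.append p.1 p.2)
      volume volume := by
  convert measurePreserving_sumElim_comp_symm (finSumFinEquiv (m := m) (n := n)) using 1
  funext p
  rw [← Fin.append_comp_sumElim]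
  funext l
  obtain ⟨s, rfl⟩ := finSumFinEquiv.surjective l
  cases s <;> simp

theorem ae_injective (m : ℕ) : ∀ᵐ x : Fin m → ℝ, Function.Injective x := by
  have h : ∀ i j : Fin m, ∀ᵐ x : Fin m → ℝ, i ≠ j → x i ≠ x j := by
    intro i j
    by_cases hij : i = j
    · simp [hij]
    let L : (Fin m → ℝ) →ₗ[ℝ] ℝ := 
      (LinearMap.proj i : (Fin m → ℝ) →ₗ[ℝ] ℝ) - LinearMap.proj j
    have hL : LinearMap.ker L ≠ ⊤ := by
      intro htop
      have : (Pi.single i (1 : ℝ) : Fin m → ℝ) ∈ LinearMap.ker L := htop ▸ Submodule.mem_top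
      simp [L, Ne.symm hij] at this
    have h0 := Measure.addHaar_submodule (volume : Measure (Fin m → ℝ)) _ hL
    rw [ae_iff]
    refine measure_mono_null (fun x hx => ?_) h0
    simp only [Set.mem_ofPred_eq, not_forall, not_not] at hx
    obtain ⟨-, hx⟩ := hx
    simp [L, hx]
  have := ae_all_iff.2 fun i => ae_all_iff.2 (h i)
  filter_upwards [this] with x hx i j hij
  by_contra hne
  exact hx i j hne hij

theorem measurable_vdm {n : ℕ} : Measurable (vdm : (Fin n → ℝ) → ℝ) := by
  unfold vdm
  fun_prop

theorem measurableSet_strictAnti (m : ℕ) : MeasurableSet {x : Fin m → ℝ | StrictAnti x} := by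
  have : {x : Fin m → ℝ | StrictAnti x} = ⋂ i, ⋂ j, ⋂ (_ : i < j), {x | x j < x i} := by
    ext x; simp [StrictAnti]
  rw [this]
  exact MeasurableSet.iInter fun i => MeasurableSet.iInter fun j => MeasurableSet.iInter fun _ =>
    measurableSet_lt (measurable_pi_apply j) (measurable_pi_apply i)

/-- The permutation that lists `x` in decreasing order. -/
noncomputable def decrPerm {m : ℕ} (x : Fin m → ℝ) : Equiv.Perm (Fin m) :=
  Fin.revPerm.trans (Tuple.sort x)

theorem comp_decrPerm {m : ℕ} (x : Fin m → ℝ) : x ∘ decrPerm x = decr x := rfl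

theorem decr_strictAnti {m : ℕ} {x : Fin m → ℝ} (hx : Function.Injective x) :
    StrictAnti (decr x) := by
  have h : StrictMono (x ∘ Tuple.sort x) :=
    (Tuple.monotone_sort x).strictMono_of_injective (hx.comp (Tuple.sort x).injective)
  intro i j hij
  exact h (Fin.rev_lt_rev.2 hij)

theorem comp_eq_decr {m : ℕ} {x : Fin m → ℝ} {σ : Equiv.Perm (Fin m)}
    (h : StrictAnti (x ∘ σ)) : x ∘ σ = decr x := by
  have h2 : Monotone (x ∘ (Fin.revPerm.trans σ : Equiv.Perm (Fin m))) := fun i j hij =>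
    h.antitone (Fin.rev_le_rev.2 hij)
  have h3 := Tuple.comp_sort_eq_comp_iff_monotone.2 h2
  funext i
  have := congrFun h3 i.rev
  simpa [decr] using this

theorem sum_indicator_strictAnti {m : ℕ} (Φ : (Fin m → ℝ) → ℝ≥0∞) {x : Fin m → ℝ}
    (hx : Function.Injective x) :
    ∑ σ : Equiv.Perm (Fin m), {x | StrictAnti x}.indicator Φ (x ∘ σ) = Φ (decr x) := by
  rw [Finset.sum_eq_single (decrPerm x), comp_decrPerm,
    Set.indicator_of_mem (show decr x ∈ {x | StrictAnti x} from decr_strictAnti hx)]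
  · intro σ _ hσ
    refine Set.indicator_of_notMem (fun h => hσ ?_) _
    have h1 := comp_eq_decr h
    rw [← comp_decrPerm] at h1
    exact Equiv.ext fun i => hx (congrFun h1 i)
  · simp

/-- An integral depending on the decreasing rearrangement is an integral over the chamber of
decreasing vectors of the symmetrized density. -/
theorem lintegral_comp_decr {m : ℕ} {Φ G : (Fin m → ℝ) → ℝ≥0∞} (hΦ : Measurable Φ)
    (hG : Measurable G) :
    ∫⁻ x, Φ (decr x) * G x =
      ∫⁻ x, {x | StrictAnti x}.indicator Φ x * ∑ σ : Equiv.Perm (Fin m), G (x ∘ σ) := by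
  have hI : Measurable ({x : Fin m → ℝ | StrictAnti x}.indicator Φ) :=
    hΦ.indicator (measurableSet_strictAnti m)
  have hc : ∀ σ : Equiv.Perm (Fin m), Measurable fun x : Fin m → ℝ => x ∘ σ := fun σ =>
    (measurePreserving_comp_equiv σ).measurable
  calc ∫⁻ x, Φ (decr x) * G x
      = ∫⁻ x, ∑ σ : Equiv.Perm (Fin m), {x | StrictAnti x}.indicator Φ (x ∘ σ) * G x := by
        refine lintegral_congr_ae ?_
        filter_upwards [ae_injective m] with x hx
        rw [← Finset.sum_mul, sum_indicator_strictAnti Φ hx]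
    _ = ∑ σ : Equiv.Perm (Fin m), ∫⁻ x, {x | StrictAnti x}.indicator Φ (x ∘ σ) * G x :=
        lintegral_finsetSum _ fun σ _ => (hI.comp (hc σ)).mul hG
    _ = ∑ σ : Equiv.Perm (Fin m), ∫⁻ x, {x | StrictAnti x}.indicator Φ x * G (x ∘ (σ⁻¹ : Equiv.Perm _)) := by
        refine Finset.sum_congr rfl fun σ _ => ?_
        refine (lintegral_congr fun x => ?_).trans
          ((measurePreserving_comp_equiv σ).lintegral_comp (hI.mul (hG.comp (hc σ⁻¹))))
        have : (x ∘ σ) ∘ (σ⁻¹ : Equiv.Perm (Fin m)) = x := by funext i; simp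
        simp only [this]
    _ = ∑ σ : Equiv.Perm (Fin m), ∫⁻ x, {x | StrictAnti x}.indicator Φ x * G (x ∘ σ) :=
        Equiv.sum_comp (Equiv.inv (Equiv.Perm (Fin m)))
          fun σ => ∫⁻ x, {x | StrictAnti x}.indicator Φ x * G (x ∘ σ)
    _ = _ := by
        simp only [Finset.mul_sum]
        exact (lintegral_finsetSum _ fun σ _ => hI.mul (hG.comp (hc σ))).symm

/-! ### Varying one coordinate of a generic point -/

theorem ae_removeNth {m : ℕ} (i : Fin (m + 1)) {Q : (Fin m → ℝ) → Prop} (h : ∀ᵐ v, Q v) :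
    ∀ᵐ b : Fin (m + 1) → ℝ, Q (i.removeNth b) :=
  (Measure.quasiMeasurePreserving_snd.comp
    (volume_preserving_piFinSuccAbove (fun _ : Fin (m + 1) => ℝ) i).quasiMeasurePreserving).ae h

theorem lintegral_insertNth {m : ℕ} (i : Fin (m + 1)) {ρ : (Fin (m + 1) → ℝ) → ℝ≥0∞}
    (hρ : Measurable ρ) :
    ∫⁻ x, ρ x = ∫⁻ v : Fin m → ℝ, ∫⁻ y : ℝ, ρ (i.insertNth y v) := by
  have h := (volume_preserving_piFinSuccAbove (fun _ : Fin (m + 1) => ℝ) i).symm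
  rw [← h.lintegral_comp hρ]
  exact lintegral_prod_symm _ (hρ.comp h.measurable).aemeasurable

theorem measurable_insertNth {m : ℕ} (i : Fin (m + 1)) :
    Measurable fun p : (Fin m → ℝ) × ℝ => (i.insertNth p.2 p.1 : Fin (m + 1) → ℝ) :=
  (volume_preserving_piFinSuccAbove (fun _ : Fin (m + 1) => ℝ) i).symm.measurable.comp
    measurable_swap

theorem insertNth_removeNth_eq_update {m : ℕ} (i : Fin (m + 1)) (y : ℝ) (b : Fin (m + 1) → ℝ) :
    (i.insertNth y (i.removeNth b) : Fin (m + 1) → ℝ) = Function.update b i y := by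
  rw [Fin.insertNth_removeNth]

/-- In a finite integral, the partial integral over any one coordinate is finite at almost every
point. -/
theorem ae_lintegral_update_lt_top {n : ℕ} {ρ : (Fin n → ℝ) → ℝ≥0∞} (hρ : Measurable ρ)
    (hfin : ∫⁻ x, ρ x ≠ ∞) : ∀ᵐ b : Fin n → ℝ, ∀ i, ∫⁻ y, ρ (Function.update b i y) < ∞ := by
  cases n with
  | zero => exact Filter.Eventually.of_forall fun b i => i.elim0
  | succ m =>
    refine ae_all_iff.2 fun i => ?_
    rw [lintegral_insertNth i hρ] at hfin
    have := ae_removeNth i (ae_lt_top (hρ.comp (measurable_insertNth i)).lintegral_prod_right' hfin)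
    filter_upwards [this] with b hb
    simpa only [Function.comp_def, insertNth_removeNth_eq_update] using hb

/-- If a property holds almost everywhere, then for almost every base point it holds almost
everywhere along each coordinate line through that point. -/
theorem ae_ae_update {n : ℕ} {P : (Fin n → ℝ) → Prop} (h : ∀ᵐ x, P x) :
    ∀ᵐ b : Fin n → ℝ, ∀ i, ∀ᵐ y : ℝ, P (Function.update b i y) := by
  cases n with
  | zero => exact Filter.Eventually.of_forall fun b i => i.elim0
  | succ m =>
    refine ae_all_iff.2 fun i => ?_
    have h1 := (volume_preserving_piFinSuccAbove
      (fun _ : Fin (m + 1) => ℝ) i).symm.quasiMeasurePreserving.ae h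
    have h2 := Measure.ae_ae_of_ae_prod
      (Measure.measurePreserving_swap (μ := (volume : Measure (Fin m → ℝ)))
        (ν := (volume : Measure ℝ)) |>.quasiMeasurePreserving.ae h1)
    filter_upwards [ae_removeNth i h2] with b hb
    filter_upwards [hb] with y hy
    rw [← insertNth_removeNth_eq_update]
    exact hy

/-! ### Tail moments of the weight -/

/-- The tail integral `∫_y^∞ q(z) f(z) dz` of a polynomial against the weight `f`. -/
noncomputable def tail (f : ℝ → ℝ) (q : Polynomial ℝ) (y : ℝ) : ℝ :=
  ∫ z in Set.Ioi y, q.eval z * f z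

/-- The matrix of the tail moments `∫_{y_i}^∞ z^k f(z) dz`. -/
noncomputable def tailMatrix {n : ℕ} (f : ℝ → ℝ) (y : Fin n → ℝ) : Matrix (Fin n) (Fin n) ℝ :=
  Matrix.of fun i k => tail f (Polynomial.X ^ (k : ℕ)) (y i)

/-- Cramer's rule without division. -/
theorem det_mul_dotProduct {n : ℕ} (B : Matrix (Fin n) (Fin n) ℝ) (v x : Fin n → ℝ) :
    B.det * (v ⬝ᵥ x) = ∑ i, (B.updateRow i v).det * B.mulVec x i := by
  have h : ∀ i, (B.updateRow i v).det = Matrix.vecMul v B.adjugate i := by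
    intro i
    rw [← Matrix.cramer_transpose_apply, Matrix.cramer_eq_adjugate_mulVec,
      ← Matrix.adjugate_transpose, Matrix.mulVec_transpose]
  simp only [h]
  change _ = Matrix.vecMul v B.adjugate ⬝ᵥ B.mulVec x
  rw [← Matrix.dotProduct_mulVec, Matrix.mulVec_mulVec, Matrix.adjugate_mul, Matrix.smul_mulVec,
    Matrix.one_mulVec, dotProduct_smul, smul_eq_mul]

theorem dotProduct_coeff_eq_eval {n : ℕ} {q : Polynomial ℝ} (hq : q.degree < n) (y : ℝ) :
    (fun k : Fin n => y ^ (k : ℕ)) ⬝ᵥ (fun k : Fin n => q.coeff k) = q.eval y := by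
  rcases eq_or_ne q 0 with rfl | h0
  · simp [dotProduct]
  · rw [Polynomial.eval_eq_sum_range' ((Polynomial.natDegree_lt_iff_degree_lt h0).2 hq),
      ← Fin.sum_univ_eq_sum_range fun k => q.coeff k * y ^ k]
    exact Finset.sum_congr rfl fun k _ => mul_comm _ _

theorem vandermonde_mulVec_coeff {n : ℕ} {q : Polynomial ℝ} (hq : q.degree < n)
    (b : Fin n → ℝ) (i : Fin n) :
    (Matrix.vandermonde b).mulVec (fun k : Fin n => q.coeff k) i = q.eval (b i) :=
  dotProduct_coeff_eq_eval hq (b i)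

theorem det_updateRow_vandermonde {n : ℕ} (b : Fin n → ℝ) (i : Fin n) (y : ℝ) :
    ((Matrix.vandermonde b).updateRow i fun k => y ^ (k : ℕ)).det =
      vdm (Function.update b i y) := by
  rw [vdm_eq_det]
  congr 1
  ext j k
  by_cases h : j = i
  · subst h; simp [Matrix.vandermonde_apply]
  · simp [Matrix.vandermonde_apply, h]

/-- Lagrange interpolation, with the denominators cleared. -/
theorem vdm_mul_eval {n : ℕ} {q : Polynomial ℝ} (hq : q.degree < n) (b : Fin n → ℝ) (y : ℝ) :
    vdm b * q.eval y = ∑ i, vdm (Function.update b i y) * q.eval (b i) := by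
  have h := det_mul_dotProduct (Matrix.vandermonde b) (fun k => y ^ (k : ℕ))
    (fun k : Fin n => q.coeff k)
  rw [dotProduct_coeff_eq_eval hq, ← vdm_eq_det] at h
  rw [h]
  refine Finset.sum_congr rfl fun i _ => ?_
  rw [det_updateRow_vandermonde, vandermonde_mulVec_coeff hq]

/-- The unnormalized density of the ensembles. -/
noncomputable def dens (β n : ℕ) (w : ℝ → ℝ) (x : Fin n → ℝ) : ℝ≥0∞ :=
  ENNReal.ofReal ((∏ i, w (x i)) * |vdm x| ^ β)

theorem measurable_dens {β n : ℕ} {w : ℝ → ℝ} (hw : Measurable w) :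
    Measurable (dens β n w) := by
  unfold dens
  refine ENNReal.measurable_ofReal.comp ((Finset.measurable_prod _ fun i _ =>
    hw.comp (measurable_pi_apply i)).mul ?_)
  exact ((continuous_abs.measurable).comp measurable_vdm).pow_const _

theorem prod_update {n : ℕ} (w : ℝ → ℝ) (b : Fin n → ℝ) (i : Fin n) (y : ℝ) :
    ∏ j, w (Function.update b i y j) = w y * ∏ j ∈ Finset.univ \ {i}, w (b j) := by
  rw [← Finset.prod_update_of_mem (Finset.mem_univ i) (fun j => w (b j)) (w y)]
  refine Finset.prod_congr rfl fun j _ => ?_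
  by_cases h : j = i
  · subst h; simp
  · simp [h]

/-- Integrability of the `β = 1` density forces the moments of order `< n` of the weight to be
finite: through `n` generic base points, every polynomial of degree `< n` is a combination of the
polynomials occurring in the density along the coordinate lines. -/
theorem integrable_eval_mul {n : ℕ} {f : ℝ → ℝ} (hf0 : ∀ x, 0 ≤ f x) (hfm : Measurable f)
    (hfin : ∫⁻ x, dens 1 n f x ≠ ∞) (hne : ∫⁻ x, dens 1 n f x ≠ 0) {q : Polynomial ℝ}
    (hq : q.degree < n) : Integrable fun z => q.eval z * f z := by
  have h1 : ∃ᵐ b, dens 1 n f b ≠ 0 := by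
    intro h
    refine hne ((lintegral_eq_zero_iff (measurable_dens hfm)).2 ?_)
    filter_upwards [h] with b hb
    simpa using hb
  obtain ⟨b, hb, hb2⟩ :=
    (h1.and_eventually (ae_lintegral_update_lt_top (measurable_dens hfm) hfin)).exists
  rw [dens, ne_eq, ENNReal.ofReal_eq_zero, not_le, pow_one] at hb
  have hv : vdm b ≠ 0 := fun h => by simp [h] at hb
  have hp : ∏ i, f (b i) ≠ 0 := fun h => by simp [h] at hb
  have hint : ∀ i, Integrable fun z => vdm (Function.update b i z) * f z := by
    intro i
    have hm : Measurable fun z => vdm (Function.update b i z) * f z :=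
      (measurable_vdm.comp (measurable_update b)).mul hfm
    refine ⟨hm.aestronglyMeasurable, ?_⟩
    set c := ∏ j ∈ Finset.univ \ {i}, f (b j) with hc
    have hc0 : 0 ≤ c := Finset.prod_nonneg fun j _ => hf0 _
    have hcne : c ≠ 0 := Finset.prod_ne_zero_iff.2 fun j _ =>
      (Finset.prod_ne_zero_iff.1 hp) j (Finset.mem_univ j)
    have hd : ∀ y, dens 1 n f (Function.update b i y) =
        ENNReal.ofReal c * ‖vdm (Function.update b i y) * f y‖ₑ := by
      intro y
      rw [dens, prod_update, ← hc, Real.enorm_eq_ofReal_abs, ← ENNReal.ofReal_mul hc0, abs_mul,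
        abs_of_nonneg (hf0 y), pow_one]
      congr 1; ring
    have h3 := hb2 i
    simp only [hd] at h3
    rw [lintegral_const_mul _ hm.enorm] at h3
    rcases ENNReal.mul_lt_top_iff.1 h3 with h | h | h
    · exact h.2
    · exact absurd (le_antisymm (ENNReal.ofReal_eq_zero.1 h) hc0) hcne
    · exact h.trans_lt ENNReal.zero_lt_top
  have heq : (fun z => q.eval z * f z) =
      fun z => (vdm b)⁻¹ * ∑ i, q.eval (b i) * (vdm (Function.update b i z) * f z) := by
    funext z
    rw [eq_inv_mul_iff_mul_eq₀ hv, ← mul_assoc, vdm_mul_eval hq, Finset.sum_mul]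
    exact Finset.sum_congr rfl fun i _ => by ring
  rw [heq]
  exact (integrable_finsetSum _ fun i _ => (hint i).const_mul _).const_mul _

/-! ### The interlacing integral -/

/-- The sign of the Vandermonde product of a decreasing list. -/
noncomputable def antiSign (n : ℕ) : ℝ := ∏ i : Fin n, ∏ _j ∈ Finset.Ioi i, (-1 : ℝ)

theorem abs_antiSign (n : ℕ) : |antiSign n| = 1 := by
  simp [antiSign, Finset.abs_prod]

theorem antiSign_mul_vdm {n : ℕ} {x : Fin n → ℝ} (hx : StrictAnti x) :
    antiSign n * vdm x = |vdm x| := by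
  have : 0 ≤ antiSign n * vdm x := by
    rw [antiSign, vdm, ← Finset.prod_mul_distrib]
    refine Finset.prod_nonneg fun i _ => ?_
    rw [← Finset.prod_mul_distrib]
    refine Finset.prod_nonneg fun j hj => ?_
    have := hx (Finset.mem_Ioi.1 hj)
    linarith
  rw [← abs_of_nonneg this, abs_mul, abs_antiSign, one_mul]

/-- The list whose odd-ranked entries are `z` and whose even-ranked entries are `y`. -/
noncomputable def interlace {n : ℕ} (z y : Fin n → ℝ) : Fin (n + n) → ℝ :=
  Sum.elim z y ∘ (parityEquiv n).symm

theorem interlace_parityEquiv {n : ℕ} (z y : Fin n → ℝ) (s : Fin n ⊕ Fin n) :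
    interlace z y (parityEquiv n s) = Sum.elim z y s := by
  simp [interlace]

/-- For decreasing `y`, the open interval in which the `i`-th odd-ranked entry has to lie. -/
def gap {m : ℕ} (y : Fin (m + 1) → ℝ) : Fin (m + 1) → Set ℝ :=
  Fin.cases (Set.Ioi (y 0)) fun j => Set.Ioo (y j.succ) (y j.castSucc)

theorem measurableSet_gap {m : ℕ} (y : Fin (m + 1) → ℝ) (i : Fin (m + 1)) :
    MeasurableSet (gap y i) := by
  cases i using Fin.cases <;> simp [gap]

theorem strictAnti_interlace_iff {m : ℕ} {y : Fin (m + 1) → ℝ} (hy : StrictAnti y)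
    (z : Fin (m + 1) → ℝ) : StrictAnti (interlace z y) ↔ z ∈ Set.univ.pi (gap y) := by
  constructor
  · intro h i _
    have key : ∀ s t, parityEquiv (m + 1) s < parityEquiv (m + 1) t →
        Sum.elim z y t < Sum.elim z y s := fun s t hst => by
      have := h hst
      rwa [interlace_parityEquiv, interlace_parityEquiv] at this
    have h1 : y i < z i := key (Sum.inl i) (Sum.inr i) (by
      rw [Fin.lt_def, parityEquiv_inl, parityEquiv_inr]; omega)
    cases i using Fin.cases with
    | zero => exact h1
    | succ j =>
      exact ⟨h1, key (Sum.inr j.castSucc) (Sum.inl j.succ) (by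
        rw [Fin.lt_def, parityEquiv_inl, parityEquiv_inr]; simp; omega)⟩
  · intro h
    have h1 : ∀ i, y i < z i := fun i => by
      have := h i (Set.mem_univ i)
      cases i using Fin.cases with
      | zero => exact this
      | succ j => exact this.1
    have h2 : ∀ i j, i < j → z j < y i := fun i j hij => by
      have := h j (Set.mem_univ j)
      cases j using Fin.cases with
      | zero => exact absurd hij (Fin.not_lt_zero i)
      | succ j =>
        exact this.2.trans_le (hy.antitone (Fin.le_castSucc_iff.2 hij))
    intro k l hkl
    obtain ⟨s, rfl⟩ := (parityEquiv (m + 1)).surjective k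
    obtain ⟨t, rfl⟩ := (parityEquiv (m + 1)).surjective l
    rw [interlace_parityEquiv, interlace_parityEquiv]
    rw [Fin.lt_def] at hkl
    rcases s with a | a <;> rcases t with b | b <;>
      simp only [parityEquiv_inl, parityEquiv_inr] at hkl <;> simp only [Sum.elim_inl, Sum.elim_inr]
    · exact (h2 a b (by rw [Fin.lt_def]; omega)).trans (h1 a)
    · exact (hy.antitone (show a ≤ b by rw [Fin.le_def]; omega)).trans_lt (h1 a)
    · exact h2 a b (by rw [Fin.lt_def]; omega)
    · exact hy (by rw [Fin.lt_def]; omega)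

theorem det_tailMatrix_eq_det_gap {m : ℕ} {f : ℝ → ℝ}
    (hint : ∀ q : Polynomial ℝ, q.degree < (m + 1 : ℕ) → Integrable fun z => q.eval z * f z)
    {y : Fin (m + 1) → ℝ} (hy : StrictAnti y) :
    (tailMatrix f y).det =
      (Matrix.of fun i k : Fin (m + 1) => ∫ z in gap y i, z ^ (k : ℕ) * f z).det := by
  refine Matrix.det_eq_of_forall_row_eq_smul_add_pred (fun _ => 1) (fun k => ?_) fun i k => ?_
  · simp [tailMatrix, tail, gap]
  · have hk : Integrable fun z => z ^ (k : ℕ) * f z := by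
      have := hint (Polynomial.X ^ (k : ℕ)) (by
        rw [Polynomial.degree_X_pow]; exact_mod_cast k.2)
      simpa using this
    have hlt : y i.succ ≤ y i.castSucc := hy.antitone (Fin.castSucc_lt_succ).le
    simp only [tailMatrix, tail, gap, Matrix.of_apply, Fin.cases_succ, Polynomial.eval_pow,
      Polynomial.eval_X, one_mul]
    rw [← integral_Ioc_eq_integral_Ioo, ← Set.Ioc_union_Ioi_eq_Ioi hlt,
      setIntegral_union (Set.Ioc_disjoint_Ioi le_rfl) measurableSet_Ioi hk.integrableOn
        hk.integrableOn]

/-- The `β = 1` density integrated over the odd-ranked entries interlacing with a given decreasing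
list `y` is, up to sign, the determinant of the tail moments: subtracting consecutive rows turns
tails into integrals over the gaps, and the Leibniz expansion is integrated factor by factor. -/
theorem lintegral_interlace {n : ℕ} {f : ℝ → ℝ} (hn : n ≠ 0) (hf0 : ∀ x, 0 ≤ f x)
    (hint : ∀ q : Polynomial ℝ, q.degree < (n : ℕ) → Integrable fun z => q.eval z * f z)
    {y : Fin n → ℝ} (hy : StrictAnti y) :
    0 ≤ antiSign n * (tailMatrix f y).det ∧
    ∫⁻ z, {z | StrictAnti (interlace z y)}.indicator (dens 1 n f) z =
      ENNReal.ofReal (antiSign n * (tailMatrix f y).det) := by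
  obtain ⟨m, rfl⟩ := Nat.exists_eq_succ_of_ne_zero hn
  set S := Set.univ.pi (gap y) with hS
  have hSm : MeasurableSet S := MeasurableSet.univ_pi (measurableSet_gap y)
  have hset : {z | StrictAnti (interlace z y)} = S := by
    ext z; exact strictAnti_interlace_iff hy z
  have hpow : ∀ k : Fin (m + 1), Integrable fun z => z ^ (k : ℕ) * f z := fun k => by
    have := hint (Polynomial.X ^ (k : ℕ)) (by
      rw [Polynomial.degree_X_pow]; exact_mod_cast k.2)
    simpa using this
  have hanti : ∀ z ∈ S, StrictAnti z := fun z hz => by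
    have h := (strictAnti_interlace_iff hy z).2 hz
    intro i j hij
    have h2 := h (show parityEquiv (m + 1) (Sum.inl i) < parityEquiv (m + 1) (Sum.inl j) by
      rw [Fin.lt_def, parityEquiv_inl, parityEquiv_inl]; rw [Fin.lt_def] at hij; omega)
    rwa [interlace_parityEquiv, interlace_parityEquiv] at h2
  -- the Leibniz expansion of the integrand is a sum of products of one-variable functions
  have hexp : ∀ z : Fin (m + 1) → ℝ, (∏ i, f (z i)) * vdm z =
      ∑ τ : Equiv.Perm (Fin (m + 1)), ((Equiv.Perm.sign τ : ℤ) : ℝ) *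
        ∏ i, (z i ^ (τ i : ℕ) * f (z i)) := by
    intro z
    rw [vdm_eq_det, ← Matrix.det_transpose, Matrix.det_apply', Finset.mul_sum]
    refine Finset.sum_congr rfl fun τ _ => ?_
    simp only [Matrix.transpose_apply, Matrix.vandermonde_apply, Finset.prod_mul_distrib]
    ring
  have hrestr : (volume : Measure (Fin (m + 1) → ℝ)).restrict S =
      Measure.pi fun i => (volume : Measure ℝ).restrict (gap y i) := by
    rw [volume_pi, hS, Measure.restrict_pi_pi]
  have hterm : ∀ τ : Equiv.Perm (Fin (m + 1)), Integrable
      (fun z : Fin (m + 1) → ℝ => ((Equiv.Perm.sign τ : ℤ) : ℝ) *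
        ∏ i, (z i ^ (τ i : ℕ) * f (z i))) (volume.restrict S) := by
    intro τ
    rw [hrestr]
    exact (Integrable.fintype_prod (f := fun i t => t ^ (τ i : ℕ) * f t)
      fun i => (hpow (τ i)).restrict).const_mul _
  have hI : Integrable (fun z => (∏ i, f (z i)) * vdm z) (volume.restrict S) := by
    simp only [hexp]
    exact integrable_finsetSum _ fun τ _ => hterm τ
  have hval : ∫ z in S, (∏ i, f (z i)) * vdm z = (tailMatrix f y).det := by
    rw [det_tailMatrix_eq_det_gap hint hy, ← Matrix.det_transpose, Matrix.det_apply']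
    simp only [hexp]
    rw [integral_finsetSum _ fun τ _ => hterm τ]
    refine Finset.sum_congr rfl fun τ _ => ?_
    rw [integral_const_mul, hrestr,
      integral_fintype_prod_eq_prod (f := fun i t => t ^ (τ i : ℕ) * f t)]
    simp
  have hnn : ∀ z ∈ S, 0 ≤ antiSign (m + 1) * ((∏ i, f (z i)) * vdm z) := fun z hz => by
    rw [mul_left_comm, antiSign_mul_vdm (hanti z hz)]
    exact mul_nonneg (Finset.prod_nonneg fun i _ => hf0 _) (abs_nonneg _)
  have hae : 0 ≤ᵐ[volume.restrict S] fun z => antiSign (m + 1) * ((∏ i, f (z i)) * vdm z) := by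
    filter_upwards [ae_restrict_mem hSm] with z hz using hnn z hz
  constructor
  · rw [← hval, ← integral_const_mul]
    exact integral_nonneg_of_ae hae
  · rw [← hval, ← integral_const_mul, ofReal_integral_eq_lintegral_ofReal (hI.const_mul _) hae,
      hset, lintegral_indicator hSm]
    refine setLIntegral_congr_fun hSm fun z hz => ?_
    simp only [dens, pow_one]
    rw [mul_left_comm, antiSign_mul_vdm (hanti z hz)]

/-! ### The density of the even-ranked eigenvalues of a superposition -/

theorem weightMeasure_univ (β n : ℕ) (w : ℝ → ℝ) :
    weightMeasure β n w Set.univ = ∫⁻ x, dens β n w x := by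
  rw [weightMeasure, withDensity_apply _ MeasurableSet.univ, Measure.restrict_univ]
  rfl

theorem lintegral_ensemble {β n : ℕ} {w : ℝ → ℝ} (hw : Measurable w)
    {φ : (Fin n → ℝ) → ℝ≥0∞} (hφ : Measurable φ) :
    ∫⁻ x, φ x ∂(ensemble β n w) = (∫⁻ x, dens β n w x)⁻¹ * ∫⁻ x, φ x * dens β n w x := by
  rw [ensemble, lintegral_smul_measure, weightMeasure_univ, smul_eq_mul,
    show weightMeasure β n w = volume.withDensity (dens β n w) from rfl, lintegral_withDensity_eq_lintegral_mul _ (measurable_dens hw) hφ]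
  simp only [Pi.mul_apply, mul_comm]

theorem mass_ne_of_isProbabilityMeasure {β n : ℕ} {w : ℝ → ℝ}
    (h : IsProbabilityMeasure (ensemble β n w)) :
    ∫⁻ x, dens β n w x ≠ 0 ∧ ∫⁻ x, dens β n w x ≠ ∞ := by
  have h1 := h.measure_univ
  rw [ensemble, Measure.smul_apply, weightMeasure_univ, smul_eq_mul] at h1
  constructor <;> intro h0 <;> simp [h0] at h1

theorem dens_comp_perm {β n : ℕ} (w : ℝ → ℝ) (x : Fin n → ℝ) (σ : Equiv.Perm (Fin n)) :
    dens β n w (x ∘ σ) = dens β n w x := by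
  have h : |((Equiv.Perm.sign σ : ℤ) : ℝ)| = 1 := by
    rcases Int.units_eq_one_or (Equiv.Perm.sign σ) with h | h <;> simp [h]
  simp only [dens, vdm_comp_perm, abs_mul, h, one_mul, Function.comp]
  rw [Equiv.prod_comp σ fun i => w (x i)]

theorem lintegral_orderedLaw {β n : ℕ} {w : ℝ → ℝ} (hw : Measurable w)
    {φ : (Fin n → ℝ) → ℝ≥0∞} (hφ : Measurable φ) :
    ∫⁻ x, φ x ∂(orderedLaw (ensemble β n w)) = ∫⁻ y, {y | StrictAnti y}.indicator φ y *
      ((∫⁻ x, dens β n w x)⁻¹ * n.factorial * dens β n w y) := by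
  have hI := hφ.indicator (measurableSet_strictAnti n)
  rw [orderedLaw, lintegral_map hφ measurable_decr,
    lintegral_ensemble hw (show Measurable fun x => φ (decr x) from hφ.comp measurable_decr),
    lintegral_comp_decr hφ (measurable_dens hw)]
  simp only [dens_comp_perm, Finset.sum_const, Finset.card_univ, Fintype.card_perm,
    Fintype.card_fin, nsmul_eq_mul]
  rw [← lintegral_const_mul _ (show Measurable fun y => {y | StrictAnti y}.indicator φ y *
    (n.factorial * dens β n w y) from hI.mul ((measurable_dens hw).const_mul _))]
  refine lintegral_congr fun y => ?_
  ring

/-- The unnormalized density of two superposed independent ensembles. -/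
noncomputable def superDens (n : ℕ) (w : ℝ → ℝ) (x : Fin (n + n) → ℝ) : ℝ≥0∞ :=
  dens 1 n w (fun i => x (Fin.castAdd n i)) * dens 1 n w fun i => x (Fin.natAdd n i)

theorem measurable_superDens {n : ℕ} {w : ℝ → ℝ} (hw : Measurable w) :
    Measurable (superDens n w) :=
  ((measurable_dens hw).comp (measurable_pi_lambda _ fun _ => measurable_pi_apply _)).mul
    ((measurable_dens hw).comp (measurable_pi_lambda _ fun _ => measurable_pi_apply _))

theorem lintegral_superpose {n : ℕ} {f : ℝ → ℝ} (hf : Measurable f)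
    {Φ : (Fin (n + n) → ℝ) → ℝ≥0∞} (hΦ : Measurable Φ) :
    ∫⁻ x, Φ x ∂(superpose (OE n f) (OE n f)) =
      (∫⁻ x, dens 1 n f x)⁻¹ * (∫⁻ x, dens 1 n f x)⁻¹ * ∫⁻ x, Φ x * superDens n f x := by
  have hd := measurable_dens (β := 1) (n := n) hf
  have hden : Measurable fun z : (Fin n → ℝ) × (Fin n → ℝ) => dens 1 n f z.1 * dens 1 n f z.2 :=
    (hd.comp measurable_fst).mul (hd.comp measurable_snd)
  rw [superpose, lintegral_map hΦ measurable_append]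
  have hsf : SFinite (weightMeasure 1 n f) := by unfold weightMeasure; infer_instance
  have hprod : (OE n f).prod (OE n f) =
      ((∫⁻ x, dens 1 n f x)⁻¹ * (∫⁻ x, dens 1 n f x)⁻¹) •
        (volume : Measure ((Fin n → ℝ) × (Fin n → ℝ))).withDensity
          fun z => dens 1 n f z.1 * dens 1 n f z.2 := by
    rw [OE, ensemble, weightMeasure_univ, Measure.prod_smul_left, Measure.prod_smul_right,
      smul_smul, Measure.volume_eq_prod, ← prod_withDensity hd hd]
    rfl
  rw [hprod, lintegral_smul_measure, smul_eq_mul]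
  congr 1
  rw [lintegral_withDensity_eq_lintegral_mul _ hden
      (show Measurable fun p : (Fin n → ℝ) × (Fin n → ℝ) => Φ (Fin.append p.1 p.2) from
        hΦ.comp measurable_append)]
  refine (lintegral_congr fun p => ?_).trans
    ((measurePreserving_append n n).lintegral_comp (hΦ.mul (measurable_superDens hf)))
  simp only [Pi.mul_apply, superDens, Fin.append_left, Fin.append_right]
  ring

/-- The constant of the summation identity. -/
noncomputable def superConst (n : ℕ) : ℝ := (n.factorial : ℝ) ^ 2 * 2 ^ n

theorem superConst_pos (n : ℕ) : 0 < superConst n := by unfold superConst; positivity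

theorem sum_superDens {n : ℕ} {f : ℝ → ℝ} (hf0 : ∀ x, 0 ≤ f x) {w : Fin (n + n) → ℝ}
    (hw : StrictAnti w) :
    ∑ σ : Equiv.Perm (Fin (n + n)), superDens n f (w ∘ σ) =
      ENNReal.ofReal (superConst n) * (dens 1 n f (fun i => w (parityEquiv n (Sum.inl i))) *
        dens 1 n f fun i => w (parityEquiv n (Sum.inr i))) := by
  have hp : ∀ {ι : Type} [Fintype ι] (u : ι → ℝ), 0 ≤ ∏ i, f (u i) := fun u =>
    Finset.prod_nonneg fun i _ => hf0 _
  have h1 : ∀ σ : Equiv.Perm (Fin (n + n)), superDens n f (w ∘ σ) =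
      ENNReal.ofReal ((∏ l, f (w l)) * (|vdm fun i => w (σ (Fin.castAdd n i))| *
        |vdm fun i => w (σ (Fin.natAdd n i))|)) := by
    intro σ
    rw [superDens, dens, dens, ← ENNReal.ofReal_mul (mul_nonneg (hp _) (by positivity)),
      ← Equiv.prod_comp σ, Fin.prod_univ_add]
    simp only [Function.comp, pow_one]
    congr 1
    ring
  simp only [h1]
  rw [← ENNReal.ofReal_sum_of_nonneg fun σ _ => mul_nonneg (hp _) (by positivity),
    ← Finset.mul_sum, sum_abs_vdm_mul_abs_vdm hw, dens, dens,
    ← ENNReal.ofReal_mul (mul_nonneg (hp _) (by positivity)),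
    ← ENNReal.ofReal_mul (superConst_pos n).le, ← Equiv.prod_comp (parityEquiv n),
    Fintype.prod_sum_type]
  simp only [pow_one, superConst]
  congr 1
  ring

/-- The weight of the odd-ranked entries interlacing with `y`. -/
noncomputable def oddMass (n : ℕ) (f : ℝ → ℝ) (y : Fin n → ℝ) : ℝ≥0∞ :=
  ∫⁻ z, {z | StrictAnti (interlace z y)}.indicator (dens 1 n f) z

theorem measurePreserving_interlace (n : ℕ) :
    MeasurePreserving (fun p : (Fin n → ℝ) × (Fin n → ℝ) => interlace p.1 p.2) volume volume :=
  measurePreserving_sumElim_comp_symm (parityEquiv n)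

theorem measurable_oddMass_integrand {n : ℕ} {f : ℝ → ℝ} (hf : Measurable f) :
    Measurable fun p : (Fin n → ℝ) × (Fin n → ℝ) =>
      {z | StrictAnti (interlace z p.2)}.indicator (dens 1 n f) p.1 := by
  have h := ((measurable_dens (β := 1) (n := n) hf).comp measurable_fst).indicator
    ((measurePreserving_interlace n).measurable (measurableSet_strictAnti (n + n)))
  exact h

theorem measurable_oddMass {n : ℕ} {f : ℝ → ℝ} (hf : Measurable f) :
    Measurable (oddMass n f) :=
  (measurable_oddMass_integrand hf).lintegral_prod_left'

theorem strictAnti_of_interlace {n : ℕ} {z y : Fin n → ℝ} (h : StrictAnti (interlace z y)) :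
    StrictAnti y := fun i j hij => by
  have h2 := h (show parityEquiv n (Sum.inr i) < parityEquiv n (Sum.inr j) by
    rw [Fin.lt_def, parityEquiv_inr, parityEquiv_inr]; rw [Fin.lt_def] at hij; omega)
  rwa [interlace_parityEquiv, interlace_parityEquiv] at h2

/-- The law of the even-ranked entries: symmetrize over the chamber of decreasing lists, apply the
summation identity, and integrate out the odd-ranked entries. -/
theorem lintegral_evenLaw {n : ℕ} {f : ℝ → ℝ} (hf0 : ∀ x, 0 ≤ f x) (hf : Measurable f)
    {φ : (Fin n → ℝ) → ℝ≥0∞} (hφ : Measurable φ) :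
    ∫⁻ y, φ y ∂(evenLaw (superpose (OE n f) (OE n f))) =
      ∫⁻ y, {y | StrictAnti y}.indicator φ y *
        ((∫⁻ x, dens 1 n f x)⁻¹ * (∫⁻ x, dens 1 n f x)⁻¹ * ENNReal.ofReal (superConst n) *
          (dens 1 n f y * oddMass n f y)) := by
  set Φ : (Fin (n + n) → ℝ) → ℝ≥0∞ := fun w => φ fun i => w (parityEquiv n (Sum.inr i)) with hΦd
  have hsel : ∀ s : Fin n → Fin n ⊕ Fin n,
      Measurable fun (w : Fin (n + n) → ℝ) i => w (parityEquiv n (s i)) := fun s =>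
    measurable_pi_lambda _ fun _ => measurable_pi_apply _
  have hΦ : Measurable Φ := hφ.comp (hsel Sum.inr)
  have hI : Measurable ({w | StrictAnti w}.indicator Φ) :=
    hΦ.indicator (measurableSet_strictAnti _)
  have hd := measurable_dens (β := 1) (n := n) hf
  obtain ⟨ψ, hψe⟩ : ∃ ψ : (Fin (n + n) → ℝ) → ℝ≥0∞, ψ = fun w =>
      {w | StrictAnti w}.indicator Φ w * (ENNReal.ofReal (superConst n) *
        (dens 1 n f (fun i => w (parityEquiv n (Sum.inl i))) *
          dens 1 n f fun i => w (parityEquiv n (Sum.inr i)))) := ⟨_, rfl⟩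
  have hψ : Measurable ψ := by
    rw [hψe]
    exact hI.mul (((hd.comp (hsel Sum.inl)).mul (hd.comp (hsel Sum.inr))).const_mul _)
  rw [evenLaw, lintegral_map hφ measurable_evenPart,
    lintegral_superpose hf
      (show Measurable fun x => φ (evenPart x) from hφ.comp measurable_evenPart)]
  have h1 : ∀ w : Fin (n + n) → ℝ, φ (evenPart w) = Φ (decr w) := fun w => rfl
  simp only [h1]
  rw [lintegral_comp_decr hΦ (measurable_superDens hf)]
  have h2 : ∀ w : Fin (n + n) → ℝ, {w | StrictAnti w}.indicator Φ w *
      ∑ σ : Equiv.Perm (Fin (n + n)), superDens n f (w ∘ σ) = ψ w := by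
    intro w
    rw [hψe]
    dsimp only
    by_cases hw : StrictAnti w
    · rw [sum_superDens hf0 hw]
    · rw [Set.indicator_of_notMem (by exact hw), zero_mul, zero_mul]
  have hψi : Measurable fun p : (Fin n → ℝ) × (Fin n → ℝ) => ψ (interlace p.1 p.2) :=
    hψ.comp (measurePreserving_interlace n).measurable
  simp only [h2]
  rw [← (measurePreserving_interlace n).lintegral_comp hψ, Measure.volume_eq_prod,
    lintegral_prod_symm _ hψi.aemeasurable, ← lintegral_const_mul _ hψi.lintegral_prod_left']
  refine lintegral_congr fun y => ?_
  simp only [hψe, interlace_parityEquiv, Sum.elim_inl, Sum.elim_inr]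
  have h3 : ∀ z, {w | StrictAnti w}.indicator Φ (interlace z y) *
      (ENNReal.ofReal (superConst n) * (dens 1 n f z * dens 1 n f y)) =
      ({y | StrictAnti y}.indicator φ y * (ENNReal.ofReal (superConst n) * dens 1 n f y)) *
        {z | StrictAnti (interlace z y)}.indicator (dens 1 n f) z := by
    intro z
    by_cases hz : StrictAnti (interlace z y)
    · rw [Set.indicator_of_mem (by exact hz), Set.indicator_of_mem
        (by exact strictAnti_of_interlace hz), Set.indicator_of_mem (by exact hz)]
      simp only [hΦd, interlace_parityEquiv, Sum.elim_inr]
      ring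
    · rw [Set.indicator_of_notMem (by exact hz), 
        Set.indicator_of_notMem (s := {z | StrictAnti (interlace z y)}) (by exact hz), zero_mul, mul_zero]
  have hdz : Measurable fun z => {z | StrictAnti (interlace z y)}.indicator (dens 1 n f) z :=
    (measurable_oddMass_integrand hf).comp (measurable_id.prodMk measurable_const)
  simp only [h3]
  rw [lintegral_const_mul _ hdz]
  simp only [oddMass]
  ring

theorem det_tailMatrix_comp_perm {n : ℕ} (f : ℝ → ℝ) (y : Fin n → ℝ) (σ : Equiv.Perm (Fin n)) :
    (tailMatrix f (y ∘ σ)).det = (Equiv.Perm.sign σ : ℤ) * (tailMatrix f y).det := by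
  rw [← Matrix.det_permute]
  rfl

/-- Equality of the laws means that the determinant of the tail moments is a product of
one-variable functions times the Vandermonde product. -/
theorem exists_det_tailMatrix_eq {n : ℕ} (hn : n ≠ 0) {f g : ℝ → ℝ} (hf0 : ∀ x, 0 ≤ f x)
    (hf : Measurable f) (hg0 : ∀ x, 0 ≤ g x) (hg : Measurable g)
    (hint : ∀ q : Polynomial ℝ, q.degree < (n : ℕ) → Integrable fun z => q.eval z * f z)
    (hfZ : ∫⁻ x, dens 1 n f x ≠ 0 ∧ ∫⁻ x, dens 1 n f x ≠ ∞)
    (hgZ : ∫⁻ x, dens 2 n g x ≠ 0 ∧ ∫⁻ x, dens 2 n g x ≠ ∞)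
    (h : evenLaw (superpose (OE n f) (OE n f)) = orderedLaw (UE n g)) :
    ∃ C : ℝ, 0 < C ∧ ∀ᵐ y : Fin n → ℝ,
      C * ((∏ i, f (y i)) * (tailMatrix f y).det) = (∏ i, g (y i)) * vdm y := by
  set Zf := ∫⁻ x, dens 1 n f x with hZf
  set Zg := ∫⁻ x, dens 2 n g x with hZg
  set A : (Fin n → ℝ) → ℝ≥0∞ := fun y => Zf⁻¹ * Zf⁻¹ * ENNReal.ofReal (superConst n) *
          (dens 1 n f y * oddMass n f y) with hA
  set B : (Fin n → ℝ) → ℝ≥0∞ := fun y => Zg⁻¹ * n.factorial * dens 2 n g y with hB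
  have hAm : Measurable A := ((measurable_dens hf).mul (measurable_oddMass hf)).const_mul _
  have hBm : Measurable B := (measurable_dens hg).const_mul _
  have hS := measurableSet_strictAnti n
  have hAB : ∀ᵐ y : Fin n → ℝ, StrictAnti y → A y = B y := by
    refine (ae_restrict_iff' hS).1
      ((withDensity_eq_iff_of_sigmaFinite hAm.aemeasurable hBm.aemeasurable).1 ?_)
    ext s hs
    have h1 := lintegral_evenLaw (n := n) hf0 hf (φ := s.indicator 1)
      (measurable_one.indicator hs)
    rw [h, UE, lintegral_orderedLaw hg (measurable_one.indicator hs)] at h1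
    have h2 : ∀ D : (Fin n → ℝ) → ℝ≥0∞,
        ∫⁻ y, {y | StrictAnti y}.indicator (s.indicator 1) y * D y =
          (volume.restrict {y | StrictAnti y}).withDensity D s := by
      intro D
      rw [withDensity_apply _ hs, Measure.restrict_restrict hs,
        ← lintegral_indicator (hs.inter hS)]
      refine lintegral_congr fun y => ?_
      by_cases hy : y ∈ s <;> by_cases hy' : StrictAnti y <;> simp [Set.indicator, hy, hy']
    rw [h2, h2] at h1
    exact h1.symm
  set a := Zf⁻¹.toReal with ha
  set b := Zg⁻¹.toReal with hb
  have ha0 : 0 < a := ENNReal.toReal_pos (ENNReal.inv_ne_zero.2 hfZ.2) (ENNReal.inv_ne_top.2 hfZ.1)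
  have hb0 : 0 < b := ENNReal.toReal_pos (ENNReal.inv_ne_zero.2 hgZ.2) (ENNReal.inv_ne_top.2 hgZ.1)
  have hK := superConst_pos n
  have hfac : (0 : ℝ) < n.factorial := by exact_mod_cast n.factorial_pos
  have hs0 : antiSign n ≠ 0 := fun h0 => by have := abs_antiSign n; simp [h0] at this
  refine ⟨a * a * superConst n / (b * n.factorial), by positivity, ?_⟩
  have hchamber : ∀ᵐ y : Fin n → ℝ, StrictAnti y →
      a * a * superConst n / (b * n.factorial) * ((∏ i, f (y i)) * (tailMatrix f y).det) =
        (∏ i, g (y i)) * vdm y := by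
    filter_upwards [hAB] with y hy hanti
    obtain ⟨hnn, hodd⟩ := lintegral_interlace hn hf0 hint hanti
    have h1 := congrArg ENNReal.toReal (hy hanti)
    simp only [hA, hB, oddMass, hodd, dens, ENNReal.toReal_mul, ENNReal.toReal_ofReal hK.le,
      ENNReal.toReal_ofReal hnn, ENNReal.toReal_natCast, pow_one] at h1
    rw [ENNReal.toReal_ofReal (mul_nonneg (Finset.prod_nonneg fun i _ => hf0 _) (abs_nonneg _)),
      ENNReal.toReal_ofReal (mul_nonneg (Finset.prod_nonneg fun i _ => hg0 _) (by positivity)),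
      ← ha, ← hb, sq, ← antiSign_mul_vdm hanti] at h1
    have hv := vdm_ne_zero hanti.injective
    rw [div_mul_eq_mul_div, div_eq_iff (by positivity)]
    refine mul_left_cancel₀ (mul_ne_zero (mul_ne_zero hs0 hs0) hv) ?_
    linear_combination h1
  have hperm : ∀ᵐ y : Fin n → ℝ, ∀ σ : Equiv.Perm (Fin n), StrictAnti (y ∘ σ) →
      a * a * superConst n / (b * n.factorial) *
        ((∏ i, f ((y ∘ σ) i)) * (tailMatrix f (y ∘ σ)).det) =
        (∏ i, g ((y ∘ σ) i)) * vdm (y ∘ σ) :=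
    ae_all_iff.2 fun σ => (measurePreserving_comp_equiv σ).quasiMeasurePreserving.ae hchamber
  filter_upwards [hperm, ae_injective n] with y hy hinj
  have h1 := hy (decrPerm y) (decr_strictAnti hinj)
  rw [det_tailMatrix_comp_perm, vdm_comp_perm] at h1
  simp only [Function.comp] at h1
  rw [Equiv.prod_comp (decrPerm y) fun i => f (y i),
    Equiv.prod_comp (decrPerm y) fun i => g (y i)] at h1
  refine mul_left_cancel₀ (a := ((Equiv.Perm.sign (decrPerm y) : ℤ) : ℝ)) ?_ ?_
  · rcases Int.units_eq_one_or (Equiv.Perm.sign (decrPerm y)) with h | h <;> simp [h]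
  · linear_combination h1

/-! ### The tail transform maps polynomials to polynomials -/

theorem exists_poly_coeff {n : ℕ} (x : Fin n → ℝ) :
    ∃ q : Polynomial ℝ, q.degree < n ∧ ∀ k : Fin n, q.coeff k = x k :=
  ⟨((Polynomial.degreeLTEquiv ℝ n).symm x).1, Polynomial.mem_degreeLT.1 (Subtype.prop _), fun k =>
    congrFun ((Polynomial.degreeLTEquiv ℝ n).apply_symm_apply x) k⟩

theorem tail_eq_dotProduct {n : ℕ} {f : ℝ → ℝ}
    (hint : ∀ q : Polynomial ℝ, q.degree < (n : ℕ) → Integrable fun z => q.eval z * f z)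
    {q : Polynomial ℝ} (hq : q.degree < n) (y : ℝ) :
    tail f q y =
      (fun k : Fin n => tail f (Polynomial.X ^ (k : ℕ)) y) ⬝ᵥ (fun k : Fin n => q.coeff k) := by
  have h1 : ∀ z, q.eval z * f z =
      ∑ k : Fin n, q.coeff k * ((Polynomial.X ^ (k : ℕ) : Polynomial ℝ).eval z * f z) := by
    intro z
    rw [← dotProduct_coeff_eq_eval hq, dotProduct, Finset.sum_mul]
    refine Finset.sum_congr rfl fun k _ => ?_
    simp only [Polynomial.eval_pow, Polynomial.eval_X]
    ring
  have hk : ∀ k : Fin n,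
      Integrable fun z => (Polynomial.X ^ (k : ℕ) : Polynomial ℝ).eval z * f z := fun k =>
    hint _ (by rw [Polynomial.degree_X_pow]; exact_mod_cast k.2)
  simp only [tail, h1, dotProduct]
  rw [integral_finsetSum _ fun k _ => ((hk k).const_mul _).restrict]
  refine Finset.sum_congr rfl fun k _ => ?_
  rw [integral_const_mul, mul_comm]

theorem det_updateRow_tailMatrix {n : ℕ} (f : ℝ → ℝ) (b : Fin n → ℝ) (i : Fin n) (y : ℝ) :
    ((tailMatrix f b).updateRow i fun k => tail f (Polynomial.X ^ (k : ℕ)) y).det =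
      (tailMatrix f (Function.update b i y)).det := by
  congr 1
  ext j k
  by_cases h : j = i
  · subst h; simp [tailMatrix]
  · simp [tailMatrix, h]

/-- Freezing all but one variable at a generic base point `b` turns the determinantal identity into
one-variable identities: up to the factor `g / f`, the tail transform of a polynomial of degree
`< n` is again such a polynomial, and all of them arise. -/
theorem tail_relation {n : ℕ} {f g : ℝ → ℝ}
    (hint : ∀ q : Polynomial ℝ, q.degree < (n : ℕ) → Integrable fun z => q.eval z * f z)
    (hg : Measurable g) (hgZ : ∫⁻ x, dens 2 n g x ≠ 0) {C : ℝ} (hC : 0 < C)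
    (h : ∀ᵐ y : Fin n → ℝ,
      C * ((∏ i, f (y i)) * (tailMatrix f y).det) = (∏ i, g (y i)) * vdm y) :
    (∀ p : Polynomial ℝ, p.degree < (n : ℕ) → ∃ q : Polynomial ℝ, q.degree < (n : ℕ) ∧
      ∀ᵐ y, f y * tail f q y = g y * p.eval y) ∧
    (∀ q : Polynomial ℝ, q.degree < (n : ℕ) → ∃ p : Polynomial ℝ, p.degree < (n : ℕ) ∧
      ∀ᵐ y, f y * tail f q y = g y * p.eval y) := by
  have h1 : ∃ᵐ b, dens 2 n g b ≠ 0 := by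
    intro h0
    refine hgZ ((lintegral_eq_zero_iff (measurable_dens hg)).2 ?_)
    filter_upwards [h0] with b hb
    simpa using hb
  obtain ⟨b, ⟨hb, hb1⟩, hb2⟩ := ((h1.and_eventually h).and_eventually (ae_ae_update h)).exists
  rw [dens, ne_eq, ENNReal.ofReal_eq_zero, not_le] at hb
  have hv : vdm b ≠ 0 := fun h => by simp [h] at hb
  have hgp : ∏ i, g (b i) ≠ 0 := fun h => by simp [h] at hb
  set B := tailMatrix f b with hB
  have hlhs : C * ((∏ i, f (b i)) * B.det) ≠ 0 := by rw [hb1]; exact mul_ne_zero hgp hv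
  have hD : B.det ≠ 0 := fun h => by simp [h] at hlhs
  have hfp : ∏ i, f (b i) ≠ 0 := fun h => by simp [h] at hlhs
  have hfi : ∀ i, f (b i) ≠ 0 := fun i => Finset.prod_ne_zero_iff.1 hfp i (Finset.mem_univ i)
  have hgi : ∀ i, g (b i) ≠ 0 := fun i => Finset.prod_ne_zero_iff.1 hgp i (Finset.mem_univ i)
  have hline : ∀ i, ∀ᵐ y, f y * (B.updateRow i fun k => tail f (Polynomial.X ^ (k : ℕ)) y).det *
      vdm b * g (b i) = g y * vdm (Function.update b i y) * B.det * f (b i) := by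
    intro i
    filter_upwards [hb2 i] with y hy
    rw [det_updateRow_tailMatrix]
    have e1 := hb1
    have hself : ∀ w : ℝ → ℝ, ∏ j, w (b j) = w (b i) * ∏ j ∈ Finset.univ \ {i}, w (b j) := by
      intro w
      rw [← prod_update, Function.update_eq_self]
    rw [prod_update, prod_update] at hy
    have hP : ∏ j ∈ Finset.univ \ {i}, f (b j) ≠ 0 :=
      Finset.prod_ne_zero_iff.2 fun j _ => hfi j
    rw [hself f, hself g] at e1
    set P := ∏ j ∈ Finset.univ \ {i}, f (b j)
    set Q := ∏ j ∈ Finset.univ \ {i}, g (b j)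
    refine mul_left_cancel₀ (mul_ne_zero hC.ne' hP) ?_
    linear_combination (vdm b * g (b i)) * hy - (g y * vdm (Function.update b i y)) * e1
  have key : ∀ p q : Polynomial ℝ, p.degree < (n : ℕ) → q.degree < (n : ℕ) →
      (∀ i, f (b i) * tail f q (b i) = g (b i) * p.eval (b i)) →
      ∀ᵐ y, f y * tail f q y = g y * p.eval y := by
    intro p q hp hq hpq
    filter_upwards [ae_all_iff.2 hline] with y hy
    have e1 := det_mul_dotProduct B (fun k : Fin n => tail f (Polynomial.X ^ (k : ℕ)) y)
      (fun k => q.coeff k)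
    rw [← tail_eq_dotProduct hint hq] at e1
    have e2 : ∀ i, B.mulVec (fun k => q.coeff k) i = tail f q (b i) := fun i =>
      (tail_eq_dotProduct hint hq (b i)).symm
    simp only [e2] at e1
    refine mul_left_cancel₀ (mul_ne_zero hD hv) ?_
    calc B.det * vdm b * (f y * tail f q y) = f y * vdm b * (B.det * tail f q y) := by ring
      _ = ∑ i, g y * B.det * (vdm (Function.update b i y) * p.eval (b i)) := by
        rw [e1, Finset.mul_sum]
        refine Finset.sum_congr rfl fun i _ => ?_
        refine mul_left_cancel₀ (hgi i) ?_
        linear_combination tail f q (b i) * hy i +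
          g y * vdm (Function.update b i y) * B.det * hpq i
      _ = g y * B.det * (vdm b * p.eval y) := by rw [← Finset.mul_sum, vdm_mul_eval hp]
      _ = _ := by ring
  have hsolve : ∀ (A : Matrix (Fin n) (Fin n) ℝ), A.det ≠ 0 → ∀ r : Fin n → ℝ,
      ∃ q : Polynomial ℝ, q.degree < (n : ℕ) ∧ A.mulVec (fun k => q.coeff k) = r := by
    intro A hA r
    obtain ⟨q, hq, hqc⟩ := exists_poly_coeff (A⁻¹.mulVec r)
    refine ⟨q, hq, ?_⟩
    rw [funext hqc, Matrix.mulVec_mulVec, Matrix.mul_nonsing_inv _ (isUnit_iff_ne_zero.2 hA),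
      Matrix.one_mulVec]
  constructor
  · intro p hp
    obtain ⟨q, hq, hqr⟩ := hsolve B hD fun i => g (b i) * p.eval (b i) / f (b i)
    refine ⟨q, hq, key p q hp hq fun i => ?_⟩
    have e := congrFun hqr i
    rw [show B.mulVec (fun k => q.coeff k) i = tail f q (b i) from
      (tail_eq_dotProduct hint hq (b i)).symm] at e
    rw [e, mul_div_cancel₀ _ (hfi i)]
  · intro q hq
    obtain ⟨p, hp, hpr⟩ := hsolve (Matrix.vandermonde b) (by rwa [← vdm_eq_det])
      fun i => f (b i) * tail f q (b i) / g (b i)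
    refine ⟨p, hp, key p q hp hq fun i => ?_⟩
    have e := congrFun hpr i
    rw [vandermonde_mulVec_coeff hp] at e
    rw [e, mul_div_cancel₀ _ (hgi i)]

/-! ### Calculus of the tail integrals -/

theorem tail_eq_sub {f : ℝ → ℝ} {q : Polynomial ℝ} (h : Integrable fun z => q.eval z * f z)
    (y : ℝ) : tail f q y = tail f q 0 - ∫ z in (0 : ℝ)..y, q.eval z * f z := by
  rw [tail, tail, ← intervalIntegral.integral_Ioi_sub_Ioi' h.integrableOn h.integrableOn]
  ring

theorem continuous_tail {f : ℝ → ℝ} {q : Polynomial ℝ} (h : Integrable fun z => q.eval z * f z) :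
    Continuous (tail f q) := by
  rw [funext (tail_eq_sub h)]
  exact continuous_const.sub
    (intervalIntegral.continuous_primitive (fun a b => h.intervalIntegrable) 0)

theorem hasDerivAt_tail {f : ℝ → ℝ} {q : Polynomial ℝ} (h : Integrable fun z => q.eval z * f z)
    {y : ℝ} (hy : ContinuousAt f y) : HasDerivAt (tail f q) (-(q.eval y * f y)) y := by
  rw [funext (tail_eq_sub h)]
  exact (intervalIntegral.integral_hasDerivAt_right h.intervalIntegrable
    h.aestronglyMeasurable.stronglyMeasurableAtFilter
    (q.continuous.continuousAt.mul hy)).const_sub _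

theorem tendsto_tail_atTop (f : ℝ → ℝ) (q : Polynomial ℝ) : Tendsto (tail f q) atTop (𝓝 0) :=
  tendsto_integral_Ioi_zero tendsto_id

theorem tail_eq_zero {f : ℝ → ℝ} {q : Polynomial ℝ} {b : ℝ} (h : ∀ y, b < y → f y = 0) :
    tail f q b = 0 :=
  setIntegral_eq_zero_of_forall_eq_zero fun z hz => by rw [h z hz, mul_zero]

theorem tail_one_pos {f : ℝ → ℝ} (hf0 : ∀ x, 0 ≤ f x)
    (h : Integrable fun z => (1 : Polynomial ℝ).eval z * f z) (hJ : IsOpen {x | 0 < f x}) {y x : ℝ}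
    (hx : 0 < f x) (hyx : y < x) : 0 < tail f 1 y := by
  simp only [Polynomial.eval_one, one_mul] at h
  simp only [tail, Polynomial.eval_one, one_mul]
  rw [setIntegral_pos_iff_support_of_nonneg_ae (Eventually.of_forall hf0) h.integrableOn]
  have : Function.support f = {x | 0 < f x} := by
    ext z; exact ⟨fun hz => lt_of_le_of_ne (hf0 z) (Ne.symm hz), fun hz => ne_of_gt hz⟩
  rw [this]
  exact (hJ.inter isOpen_Ioi).measure_pos _ ⟨x, hx, hyx⟩

/-! ### The Pearson equation -/

/-- What the equality of laws says about the weights: on `J = {f > 0}`, an open interval, the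
weight is `f = H / R` with `H > 0`, where `R = r₂ y² + r₁ y + r₀` is a quadratic polynomial and
`H' = -((n - 1) r₂ y + a₀) f`; moreover `g = f H` almost everywhere, `H` vanishes at a finite right
endpoint of `J`, and decays faster than `y ^ (-(n - 1))` at an infinite one. -/
structure PearsonPair (n : ℕ) (f g H : ℝ → ℝ) (r₂ r₁ r₀ a₀ : ℝ) : Prop where
  isOpen : IsOpen {x | 0 < f x}
  ordConnected : {x | 0 < f x}.OrdConnected
  nonneg : ∀ x, 0 ≤ f x
  integrable : Integrable f
  continuous : Continuous H
  pos : ∀ y, 0 < f y → 0 < H y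
  mul_eq : ∀ y, 0 < f y → f y * (r₂ * y ^ 2 + r₁ * y + r₀) = H y
  hasDerivAt : ∀ y, 0 < f y → HasDerivAt H (-(((n - 1) * r₂ * y + a₀) * f y)) y
  ae_eq : ∀ᵐ y, g y = f y * H y
  eq_zero : ∀ b, (∀ y, 0 < f y → y ≤ b) → H b = 0
  tendsto : ¬ BddAbove {x | 0 < f x} → ∀ p : Polynomial ℝ, p.degree < n →
    Tendsto (fun y => H y * p.eval y) atTop (𝓝 0)

/-- Here `Q j` is the polynomial whose tail integral is `H y ^ j`. That all of them have degree
`< m + 2` forces `deg R ≤ 2` and `deg (Q 0) ≤ 1`: compare the top coefficients of `Q (m + 1)` and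
`Q m`. -/
theorem coeff_of_tail_recursion {m : ℕ} {Q : ℕ → Polynomial ℝ} {R : Polynomial ℝ}
    (hQ : ∀ j, j < m + 2 → (Q j).degree < (m + 2 : ℕ))
    (h : ∀ j, j + 1 < m + 2 →
      Q (j + 1) = Polynomial.X ^ (j + 1) * Q 0 - Polynomial.C ((j : ℝ) + 1) * (Polynomial.X ^ j * R)) :
    (Q 0).coeff 1 = (m + 1) * R.coeff 2 ∧ (∀ k, 2 ≤ k → (Q 0).coeff k = 0) ∧
      ∀ k, 3 ≤ k → R.coeff k = 0 := by
  have hzero : ∀ j k, j < m + 2 → m + 2 ≤ k → (Q j).coeff k = 0 := fun j k hj hk =>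
    Polynomial.coeff_eq_zero_of_degree_lt ((hQ j hj).trans_le (by exact_mod_cast hk))
  have hrec : ∀ j k, j + 1 < m + 2 → m + 2 ≤ k + (j + 1) →
      (Q 0).coeff k = (j + 1) * R.coeff (k + 1) := by
    intro j k hj hk
    have h1 := hzero (j + 1) (k + (j + 1)) hj hk
    rw [h j hj, Polynomial.coeff_sub, Polynomial.coeff_X_pow_mul, Polynomial.coeff_C_mul,
      show k + (j + 1) = (k + 1) + j by ring, Polynomial.coeff_X_pow_mul] at h1
    linarith
  have htop : ∀ k, 1 ≤ k → (Q 0).coeff k = (m + 1) * R.coeff (k + 1) := fun k hk =>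
    hrec m k (by omega) (by omega)
  have hR : ∀ k, 2 ≤ k → R.coeff (k + 1) = 0 := by
    intro k hk
    have h1 := htop k (by omega)
    cases m with
    | zero =>
      rw [hzero 0 k (by omega) (by omega)] at h1
      simpa using h1.symm
    | succ m =>
      have h2 := hrec m k (by omega) (by omega)
      push_cast at h1
      linarith
  refine ⟨htop 1 le_rfl, fun k hk => ?_, fun k hk => ?_⟩
  · rw [htop k (by omega), hR k hk, mul_zero]
  · obtain ⟨k, rfl⟩ : ∃ l, k = l + 1 := ⟨k - 1, by omega⟩
    exact hR k (by omega)

theorem exists_pearsonPair {n : ℕ} (hn : 2 ≤ n) {f g : ℝ → ℝ} {I : Set ℝ}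
    (hI : IsOpen I) (hIc : I.OrdConnected) (hf0 : ∀ x, 0 ≤ f x) (hfI : ContinuousOn f I)
    (hfz : ∀ x, x ∉ I → f x = 0) (hg0 : ∀ x, 0 ≤ g x) (hne : ∃ x, 0 < f x)
    (hint : ∀ q : Polynomial ℝ, q.degree < (n : ℕ) → Integrable fun z => q.eval z * f z)
    (hpq : ∀ p : Polynomial ℝ, p.degree < (n : ℕ) → ∃ q : Polynomial ℝ, q.degree < (n : ℕ) ∧
      ∀ᵐ y, f y * tail f q y = g y * p.eval y)
    (hqp : ∀ q : Polynomial ℝ, q.degree < (n : ℕ) → ∃ p : Polynomial ℝ, p.degree < (n : ℕ) ∧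
      ∀ᵐ y, f y * tail f q y = g y * p.eval y) :
    ∃ H r₂ r₁ r₀ a₀, PearsonPair n f g H r₂ r₁ r₀ a₀ := by
  set J := {x | 0 < f x} with hJdef
  have hJI : J ⊆ I := fun x hx => by
    by_contra h
    exact (ne_of_gt hx) (hfz x h)
  have hcont : ∀ y ∈ I, ContinuousAt f y := fun y hy => hfI.continuousAt (hI.mem_nhds hy)
  have hJ : IsOpen J := by
    refine isOpen_iff_mem_nhds.2 fun x hx => ?_
    exact (hcont x (hJI hx)).eventually (lt_mem_nhds hx)
  have hdeg : ∀ j, j < n → (Polynomial.X ^ j : Polynomial ℝ).degree < (n : ℕ) := fun j hj => by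
    rw [Polynomial.degree_X_pow]; exact_mod_cast hj
  have hq : ∀ j, ∃ q : Polynomial ℝ, j < n → q.degree < (n : ℕ) ∧
      ∀ᵐ y, f y * tail f q y = g y * y ^ j := by
    intro j
    by_cases hj : j < n
    · obtain ⟨q, h1, h2⟩ := hpq _ (hdeg j hj)
      exact ⟨q, fun _ => ⟨h1, by simpa using h2⟩⟩
    · exact ⟨0, fun h => absurd h hj⟩
  choose Q hQ using hq
  have h0n : 0 < n := by omega
  have h1n : 1 < n := by omega
  set H := tail f (Q 0) with hH
  have hHc : Continuous H := continuous_tail (hint _ (hQ 0 h0n).1)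
  have hgH : ∀ᵐ y, g y = f y * H y := by
    filter_upwards [(hQ 0 h0n).2] with y hy
    rw [hy, pow_zero, mul_one]
  -- almost everywhere identities between continuous functions hold everywhere on `J`
  have hrel : ∀ p q : Polynomial ℝ, q.degree < (n : ℕ) →
      (∀ᵐ y, f y * tail f q y = g y * p.eval y) →
      Set.EqOn (tail f q) (fun y => H y * p.eval y) J := by
    intro p q hq h
    refine Measure.eqOn_open_of_ae_eq (μ := volume) ?_ hJ (continuous_tail (hint _ hq)).continuousOn
      (hHc.mul p.continuous).continuousOn
    filter_upwards [ae_restrict_mem hJ.measurableSet, ae_restrict_of_ae h, ae_restrict_of_ae hgH]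
      with y hyJ hy hgy
    rw [hgy, mul_assoc] at hy
    exact mul_left_cancel₀ (ne_of_gt hyJ) hy
  have h1deg : (1 : Polynomial ℝ).degree < (n : ℕ) := by
    rw [Polynomial.degree_one]; exact_mod_cast h0n
  obtain ⟨p₁, hp₁, hp₁e⟩ := hqp 1 h1deg
  have hone := hrel p₁ 1 h1deg hp₁e
  have hHnn : ∀ y ∈ J, H y = |H y| := by
    refine Measure.eqOn_open_of_ae_eq (μ := volume) ?_ hJ hHc.continuousOn hHc.abs.continuousOn
    filter_upwards [ae_restrict_mem hJ.measurableSet, ae_restrict_of_ae hgH] with y hyJ hgy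
    exact (abs_of_nonneg ((mul_nonneg_iff_of_pos_left hyJ).1 (hgy ▸ hg0 y))).symm
  have hHpos : ∀ y ∈ J, 0 < H y := by
    intro y hy
    obtain ⟨x, hyx, hx⟩ : ∃ x, y < x ∧ x ∈ J :=
      ((eventually_mem_nhdsWithin (s := Set.Ioi y)).and
        (mem_nhdsWithin_of_mem_nhds (hJ.mem_nhds hy))).exists
    have h1 := tail_one_pos hf0 (hint 1 h1deg) hJ hx hyx
    rw [hone hy] at h1
    refine lt_of_le_of_ne (by rw [hHnn y hy]; exact abs_nonneg _) fun h => ?_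
    simp [← h] at h1
  have hpow : ∀ j, j < n → Set.EqOn (tail f (Q j)) (fun y => H y * y ^ j) J := by
    intro j hj
    have := hrel (Polynomial.X ^ j) (Q j) (hQ j hj).1 (by simpa using (hQ j hj).2)
    simpa using this
  have hder : ∀ j, j < n → ∀ y ∈ J, HasDerivAt (tail f (Q j)) (-((Q j).eval y * f y)) y :=
    fun j hj y hy => hasDerivAt_tail (hint _ (hQ j hj).1) (hcont y (hJI hy))
  -- comparing derivatives on both sides of `tail (Q j) = H y ^ j`
  have hcmp : ∀ j, j < n → ∀ y ∈ J,
      (Q j).eval y * f y = (Q 0).eval y * f y * y ^ j - H y * (j * y ^ (j - 1)) := by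
    intro j hj y hy
    have h1 := hder j hj y hy
    have h2 := (hder 0 h0n y hy).mul (hasDerivAt_pow j y)
    have h3 : tail f (Q j) =ᶠ[𝓝 y] H * fun y => y ^ j := by
      filter_upwards [hJ.mem_nhds hy] with z hz using hpow j hj hz
    have h4 := h1.unique (h2.congr_of_eventuallyEq h3)
    linarith
  set R : Polynomial ℝ := Polynomial.X * Q 0 - Q 1 with hR
  have hRf : ∀ y ∈ J, f y * R.eval y = H y := by
    intro y hy
    have := hcmp 1 h1n y hy
    simp only [hR, Polynomial.eval_sub, Polynomial.eval_mul, Polynomial.eval_X]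
    simp at this
    linarith
  have hJinf : J.Infinite := by
    obtain ⟨x, hx⟩ := hne
    exact infinite_of_mem_nhds x (hJ.mem_nhds hx)
  have hrec : ∀ j, j + 1 < n → Q (j + 1) = Polynomial.X ^ (j + 1) * Q 0 -
      Polynomial.C ((j : ℝ) + 1) * (Polynomial.X ^ j * R) := by
    intro j hj
    refine Polynomial.eq_of_infinite_eval_eq _ _ (hJinf.mono fun y hy => ?_)
    have h1 := hcmp (j + 1) hj y hy
    rw [← hRf y hy] at h1
    simp only [Set.mem_ofPred_eq, Polynomial.eval_sub, Polynomial.eval_mul, Polynomial.eval_pow,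
      Polynomial.eval_X, Polynomial.eval_C]
    refine mul_right_cancel₀ (ne_of_gt hy) ?_
    rw [h1]
    push_cast
    ring
  obtain ⟨m, rfl⟩ : ∃ m, n = m + 2 := ⟨n - 2, by omega⟩
  obtain ⟨hc1, hc2, hc3⟩ := coeff_of_tail_recursion (fun j hj => (hQ j hj).1) hrec
  have hReval : ∀ y, R.eval y = R.coeff 2 * y ^ 2 + R.coeff 1 * y + R.coeff 0 := by
    intro y
    have : R.natDegree < 3 := Nat.lt_succ_of_le
      (Polynomial.natDegree_le_iff_coeff_eq_zero.2 fun k hk => hc3 k hk)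
    rw [Polynomial.eval_eq_sum_range' this]
    simp [Finset.sum_range_succ]
    ring
  have hQeval : ∀ y, (Q 0).eval y = (((m + 2 : ℕ) : ℝ) - 1) * R.coeff 2 * y + (Q 0).coeff 0 := by
    intro y
    have : (Q 0).natDegree < 2 := Nat.lt_succ_of_le
      (Polynomial.natDegree_le_iff_coeff_eq_zero.2 fun k hk => hc2 k hk)
    rw [Polynomial.eval_eq_sum_range' this]
    simp [Finset.sum_range_succ, hc1]
    ring
  have hconn : J.OrdConnected := by
    refine ⟨fun x hx z hz y hy => ?_⟩
    rcases eq_or_lt_of_le hy.2 with rfl | hyz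
    · exact hz
    -- `J` is relatively closed in `[x, z)`: at a limit point `y` one has `f y * R y = H y ≠ 0`
    refine isPreconnected_Icc.subset_of_closure_inter_subset hJ
      (s := Set.Icc x y) ⟨x, ⟨le_rfl, hy.1⟩, hx⟩ ?_ ⟨hy.1, le_rfl⟩
    rintro t ⟨htc, htx⟩
    have htI : t ∈ I := hIc.out (hJI hx) (hJI hz) ⟨htx.1, htx.2.trans hyz.le⟩
    have h1 : tail f 1 t = H t * p₁.eval t :=
      hone.closure (continuous_tail (hint 1 h1deg)) (hHc.mul p₁.continuous) htc
    have h2 := tail_one_pos hf0 (hint 1 h1deg) hJ hz (htx.2.trans_lt hyz)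
    have h3 : f t * R.eval t = H t := by
      have hcl : (𝓝[J] t).NeBot := mem_closure_iff_nhdsWithin_neBot.1 htc
      refine tendsto_nhds_unique_of_eventuallyEq (l := 𝓝[J] t)
        (((hcont t htI).mul R.continuous.continuousAt).tendsto.mono_left nhdsWithin_le_nhds)
        (hHc.continuousAt.tendsto.mono_left nhdsWithin_le_nhds) ?_
      filter_upwards [self_mem_nhdsWithin] with s hs using hRf s hs
    refine lt_of_le_of_ne (hf0 t) fun h0 => ?_
    rw [← h0, zero_mul] at h3
    rw [h1, ← h3, zero_mul] at h2
    exact lt_irrefl _ h2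
  refine ⟨H, R.coeff 2, R.coeff 1, R.coeff 0, (Q 0).coeff 0, hJ, hconn, hf0, ?_, hHc, hHpos,
    fun y hy => ?_, fun y hy => ?_, hgH, fun b hb => ?_, fun hbdd p hp => ?_⟩
  · simpa using hint 1 h1deg
  · rw [← hReval, hRf y hy]
  · rw [← hQeval]
    exact hder 0 h0n y hy
  · exact tail_eq_zero fun y hy => le_antisymm (not_lt.1 fun h => absurd (hb y h) (not_le.2 hy))
      (hf0 y)
  · obtain ⟨q, hq, hqe⟩ := hpq p hp
    refine (tendsto_tail_atTop f q).congr' ?_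
    obtain ⟨x, hx⟩ := hne
    filter_upwards [eventually_ge_atTop x] with y hy
    obtain ⟨z, hz, hyz⟩ := not_bddAbove_iff.1 hbdd y
    exact hrel p q hq hqe (hconn.out hx hz ⟨hy, hyz.le⟩)

/-! ### Solving the Pearson equation -/

section Affine

variable {f : ℝ → ℝ} {s t : ℝ}

theorem isOpen_affine_preimage (h : IsOpen {x | 0 < f x}) : IsOpen {x | 0 < f (s * x + t)} :=
  h.preimage (by fun_prop : Continuous fun x => s * x + t)

theorem ordConnected_affine_preimage (hs : 0 < s) (h : {x | 0 < f x}.OrdConnected) :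
    {x | 0 < f (s * x + t)}.OrdConnected := by
  refine ⟨fun x hx z hz y hy => ?_⟩
  exact h.out (x := s * x + t) hx (y := s * z + t) hz
    ⟨by nlinarith [mul_le_mul_of_nonneg_left hy.1 hs.le],
      by nlinarith [mul_le_mul_of_nonneg_left hy.2 hs.le]⟩

theorem isLUB_affine_preimage (hs : 0 < s) (h : IsLUB {x | 0 < f x} t) :
    IsLUB {x | 0 < f (s * x + t)} 0 := by
  constructor
  · intro x hx
    have : s * x + t ≤ t := h.1 hx
    by_contra hx0
    have := mul_pos hs (not_le.1 hx0)
    linarith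
  · intro u hu
    have : t ≤ s * u + t := h.2 fun y hy => by
      have h1 : (y - t) / s ≤ u := hu (by
        change 0 < f (s * ((y - t) / s) + t)
        rw [mul_div_cancel₀ _ hs.ne', sub_add_cancel]; exact hy)
      rw [div_le_iff₀ hs] at h1
      linarith
    by_contra hu0
    have := mul_neg_of_pos_of_neg hs (not_le.1 hu0)
    linarith

theorem affine_preimage_eq_Ioi (hs : 0 < s) {a : ℝ} (h : {x | 0 < f x} = Set.Ioi a) :
    {x | 0 < f (s * x + t)} = Set.Ioi ((a - t) / s) := by
  ext x
  have h1 : 0 < f (s * x + t) ↔ s * x + t ∈ Set.Ioi a := by rw [← h]; rfl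
  rw [Set.mem_Ioi, div_lt_iff₀ hs]
  refine h1.trans (Set.mem_Ioi.trans ?_)
  constructor <;> intro h2 <;> linarith

theorem ae_affine (hs : 0 < s) {Q : ℝ → Prop} (h : ∀ᵐ y, Q y) : ∀ᵐ x : ℝ, Q (s * x + t) := by
  have h1 : Measure.QuasiMeasurePreserving (fun x : ℝ => s * x) volume volume :=
    ⟨measurable_const_mul s, by
      rw [Real.map_volume_mul_left hs.ne']; exact Measure.smul_absolutelyContinuous⟩
  exact ((measurePreserving_add_right volume t).quasiMeasurePreserving.comp h1).ae h

end Affine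

namespace PearsonPair

variable {n : ℕ} {f g H : ℝ → ℝ} {r₂ r₁ r₀ a₀ : ℝ}

theorem quadratic_pos (P : PearsonPair n f g H r₂ r₁ r₀ a₀) {y : ℝ} (hy : 0 < f y) :
    0 < r₂ * y ^ 2 + r₁ * y + r₀ := by
  have h := P.pos y hy
  rw [← P.mul_eq y hy] at h
  exact pos_of_mul_pos_right h hy.le

/-- In an affine coordinate, `H` is a multiple of any positive solution `E` of the same first order
linear equation. -/
theorem exists_eq_const_mul (P : PearsonPair n f g H r₂ r₁ r₀ a₀) (hne : ∃ x, 0 < f x)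
    {s t : ℝ} (hs : 0 < s) {E E' : ℝ → ℝ} (hE0 : ∀ x, 0 < f (s * x + t) → 0 < E x)
    (hE : ∀ x, 0 < f (s * x + t) → HasDerivAt E (E' x) x)
    (hE' : ∀ x, 0 < f (s * x + t) → E' x * (r₂ * (s * x + t) ^ 2 + r₁ * (s * x + t) + r₀) =
      -(s * ((n - 1) * r₂ * (s * x + t) + a₀) * E x)) :
    ∃ c, 0 < c ∧ ∀ x, 0 < f (s * x + t) → H (s * x + t) = c * E x := by
  set K := {x | 0 < f (s * x + t)} with hK
  have hKo : IsOpen K := isOpen_affine_preimage P.isOpen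
  have hKc : IsPreconnected K := (ordConnected_affine_preimage hs P.ordConnected).isPreconnected
  have hder : ∀ x ∈ K, HasDerivAt (fun x => H (s * x + t) / E x) 0 x := by
    intro x hx
    have h1 : HasDerivAt (fun x => H (s * x + t))
        (-(((n - 1) * r₂ * (s * x + t) + a₀) * f (s * x + t)) * s) x := by
      have h2 : HasDerivAt (fun x : ℝ => s * x + t) s x := by
        simpa using ((hasDerivAt_id x).const_mul s).add_const t
      exact (P.hasDerivAt _ hx).comp x h2
    have h3 := h1.div (hE x hx) (hE0 x hx).ne'
    have h4 : -(((n - 1) * r₂ * (s * x + t) + a₀) * f (s * x + t)) * s * E x -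
        H (s * x + t) * E' x = 0 := by
      rw [← P.mul_eq _ hx]
      linear_combination -f (s * x + t) * hE' x hx
    rw [h4, zero_div] at h3
    exact h3
  obtain ⟨c, hc⟩ := hKo.exists_is_const_of_deriv_eq_zero hKc
    (fun x hx => (hder x hx).differentiableAt.differentiableWithinAt)
    (fun x hx => (hder x hx).deriv)
  have heq : ∀ x, 0 < f (s * x + t) → H (s * x + t) = c * E x := fun x hx => by
    rw [← hc x hx, div_mul_cancel₀ _ (hE0 x hx).ne']
  refine ⟨c, ?_, heq⟩
  obtain ⟨y, hy⟩ := hne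
  have hx : 0 < f (s * ((y - t) / s) + t) := by
    rw [mul_div_cancel₀ _ hs.ne', sub_add_cancel]; exact hy
  have := P.pos _ hx
  rw [heq _ hx] at this
  exact pos_of_mul_pos_left this (hE0 _ hx).le

theorem haveForm (P : PearsonPair n f g H r₂ r₁ r₀ a₀) {s t : ℝ} (hs : 0 < s) {E F G : ℝ → ℝ}
    {c ρ : ℝ} (hc : 0 < c) (hρ : 0 < ρ) (hH : ∀ x, 0 < f (s * x + t) → H (s * x + t) = c * E x)
    (hF : ∀ x, 0 < f (s * x + t) →
      F x * (r₂ * (s * x + t) ^ 2 + r₁ * (s * x + t) + r₀) = ρ * E x)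
    (hG : ∀ x, 0 < f (s * x + t) → G x = F x * E x) :
    HaveForm f g s t {x | 0 < f (s * x + t)} F G := by
  have hfx : ∀ x, f (s * x + t) = c / ρ * {x | 0 < f (s * x + t)}.indicator F x := by
    intro x
    by_cases hx : 0 < f (s * x + t)
    · rw [Set.indicator_of_mem (by exact hx)]
      refine mul_right_cancel₀ (P.quadratic_pos hx).ne' ?_
      rw [P.mul_eq _ hx, hH x hx, mul_assoc, hF x hx]
      field_simp
    · rw [Set.indicator_of_notMem (by exact hx), mul_zero]
      exact le_antisymm (not_lt.1 hx) (P.nonneg _)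
  refine ⟨⟨c / ρ, div_pos hc hρ, hfx⟩, c / ρ * c, mul_pos (div_pos hc hρ) hc, ?_⟩
  filter_upwards [ae_affine (t := t) hs P.ae_eq] with x hx
  rw [hx]
  by_cases hx : 0 < f (s * x + t)
  · rw [hfx x, Set.indicator_of_mem (by exact hx), Set.indicator_of_mem (by exact hx), hH x hx,
      hG x hx]
    ring
  · rw [hfx x, Set.indicator_of_notMem (by exact hx), Set.indicator_of_notMem (by exact hx)]
    ring

/-! ### Bounded support on the right -/

theorem quadratic_eq_zero (P : PearsonPair n f g H r₂ r₁ r₀ a₀) (hne : ∃ x, 0 < f x) {b : ℝ}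
    (hb : IsLUB {x | 0 < f x} b) : r₂ * b ^ 2 + r₁ * b + r₀ = 0 := by
  by_contra hRb
  have hHb : H b = 0 := P.eq_zero b fun y hy => hb.1 hy
  obtain ⟨y₀, hy₀⟩ := hne
  have hJ : ∀ y ∈ Set.Ico y₀ b, 0 < f y := by
    intro y hy
    obtain ⟨z, hz, hyz⟩ := (lt_isLUB_iff hb).1 hy.2
    exact P.ordConnected.out hy₀ hz ⟨hy.1, hyz.le⟩
  have hy₀b : y₀ < b := by
    refine lt_of_le_of_ne (hb.1 hy₀) fun h => ?_
    have := P.pos _ hy₀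
    rw [h, hHb] at this
    exact lt_irrefl _ this
  set R : ℝ → ℝ := fun y => r₂ * y ^ 2 + r₁ * y + r₀ with hR
  have hRc : Continuous R := by fun_prop
  have hR0 : ∀ y ∈ Set.Icc y₀ b, R y ≠ 0 := by
    intro y hy
    rcases eq_or_lt_of_le hy.2 with rfl | h
    · exact hRb
    · exact (P.quadratic_pos (hJ y ⟨hy.1, h⟩)).ne'
  -- if `R b ≠ 0`, the logarithmic derivative of `H` is bounded near `b`, so `H` cannot vanish there
  obtain ⟨M, hM⟩ := (isCompact_Icc (a := y₀) (b := b)).bddAbove_image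
    (f := fun y => ((n - 1) * r₂ * y + a₀) / R y) (ContinuousOn.div (by fun_prop) hRc.continuousOn hR0)
  have hmono : MonotoneOn (fun y => H y * Real.exp (M * y)) (Set.Icc y₀ b) := by
    refine monotoneOn_of_hasDerivWithinAt_nonneg (convex_Icc _ _)
      (P.continuous.mul (by fun_prop)).continuousOn
      (f' := fun y => -(((n - 1) * r₂ * y + a₀) * f y) * Real.exp (M * y) +
        H y * (Real.exp (M * y) * M)) (fun y hy => ?_) fun y hy => ?_
    · rw [interior_Icc] at hy
      have h1 := P.hasDerivAt y (hJ y ⟨hy.1.le, hy.2⟩)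
      have h2 : HasDerivAt (fun y => Real.exp (M * y)) (Real.exp (M * y) * M) y := by
        simpa using ((hasDerivAt_id y).const_mul M).exp
      exact (h1.mul h2).hasDerivWithinAt
    · rw [interior_Icc] at hy
      have hfy := hJ y ⟨hy.1.le, hy.2⟩
      have h1 : ((n - 1) * r₂ * y + a₀) / R y ≤ M := hM ⟨y, ⟨hy.1.le, hy.2.le⟩, rfl⟩
      rw [div_le_iff₀ (P.quadratic_pos hfy)] at h1
      rw [← P.mul_eq y hfy]
      have : 0 ≤ f y * Real.exp (M * y) * (M * R y - ((n - 1) * r₂ * y + a₀)) :=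
        mul_nonneg (by positivity) (by linarith)
      simp only [hR] at this
      linarith
  have h1 := hmono ⟨le_rfl, hy₀b.le⟩ ⟨hy₀b.le, le_rfl⟩ hy₀b.le
  simp only [hHb, zero_mul] at h1
  exact absurd h1 (not_le.2 (mul_pos (P.pos _ hy₀) (Real.exp_pos _)))

/-- If `H` vanishes at the right endpoint `b`, it is not bounded below near `b` by a function with
a positive limit. -/
theorem false_of_tendsto (P : PearsonPair n f g H r₂ r₁ r₀ a₀) (hne : ∃ x, 0 < f x) {b : ℝ}
    (hb : IsLUB {x | 0 < f x} b) {φ : ℝ → ℝ} {l : ℝ} (hl : 0 < l)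
    (hφ : Tendsto φ (𝓝[<] 0) (𝓝 l))
    (h : ∀ x, -1 < x → x < 0 → 0 < f (1 * x + b) → φ x ≤ H (1 * x + b)) : False := by
  have hHb : H b = 0 := P.eq_zero b fun y hy => hb.1 hy
  have h1 : Tendsto (fun x => H (1 * x + b)) (𝓝[<] 0) (𝓝 0) := by
    have : Tendsto (fun x => H (1 * x + b)) (𝓝 0) (𝓝 (H (1 * 0 + b))) :=
      (P.continuous.comp (by fun_prop : Continuous fun x : ℝ => 1 * x + b)).tendsto 0
    rw [mul_zero, zero_add, hHb] at this
    exact this.mono_left nhdsWithin_le_nhds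
  obtain ⟨y₀, hy₀⟩ := hne
  have hy₀b : y₀ < b := by
    refine lt_of_le_of_ne (hb.1 hy₀) fun h => ?_
    have := P.pos _ hy₀
    rw [h, hHb] at this
    exact lt_irrefl _ this
  have h2 : ∀ᶠ x in 𝓝[<] (0 : ℝ), φ x ≤ H (1 * x + b) := by
    have h3 : ∀ᶠ x in 𝓝[<] (0 : ℝ), max (-1) (y₀ - b) < x :=
      mem_nhdsWithin_of_mem_nhds (lt_mem_nhds (max_lt (by norm_num) (by linarith)))
    filter_upwards [h3, self_mem_nhdsWithin] with x hx hx0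
    have hx0 : x < 0 := hx0
    obtain ⟨hx1, hx2⟩ := max_lt_iff.1 hx
    refine h x hx1 hx0 ?_
    obtain ⟨z, hz, hyz⟩ := (lt_isLUB_iff hb).1 (show 1 * x + b < b by linarith)
    exact P.ordConnected.out hy₀ hz ⟨by linarith, hyz.le⟩
  exact absurd (le_of_tendsto_of_tendsto hφ h1 h2) (not_le.2 hl)

/-- A simple root of `R` at the right endpoint gives the power weight; `H b = 0` makes the exponent of
`H` at `b` positive. -/
theorem form_of_simple_root (P : PearsonPair n f g H r₂ r₁ r₀ a₀) (hne : ∃ x, 0 < f x) {b : ℝ}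
    (hb : IsLUB {x | 0 < f x} b) {ρ r A : ℝ} (hρ : 0 < ρ)
    (hR : ∀ x, r₂ * (1 * x + b) ^ 2 + r₁ * (1 * x + b) + r₀ = ρ * (-x) * (1 - r * x))
    (hq : ∀ x, (n - 1) * r₂ * (1 * x + b) + a₀ = (n - 1) * r * ρ * x + A)
    (hneg : ∀ x, 0 < f (1 * x + b) → x < 0) (hpos : ∀ x, 0 < f (1 * x + b) → 0 < 1 - r * x) :
    -1 < A / ρ - 1 ∧ HaveForm f g 1 b {x | 0 < f (1 * x + b)}
      (fun x => (-x) ^ (A / ρ - 1) * (1 - r * x) ^ (-(n : ℝ) - 1 - (A / ρ - 1)))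
      (fun x => (-x) ^ (2 * (A / ρ - 1) + 1) *
        (1 - r * x) ^ (-2 * (n : ℝ) - 1 - 2 * (A / ρ - 1))) := by
  set a := A / ρ with ha
  have hA : A = a * ρ := by rw [ha, div_mul_cancel₀ _ hρ.ne']
  set κ : ℝ := -(n : ℝ) + 1 - a with hκ
  obtain ⟨c, hc, hH⟩ := P.exists_eq_const_mul hne (s := 1) (t := b) one_pos
    (E := fun x => (-x) ^ a * (1 - r * x) ^ κ)
    (E' := fun x => -1 * a * (-x) ^ (a - 1) * (1 - r * x) ^ κ +
      (-x) ^ a * (-r * κ * (1 - r * x) ^ (κ - 1)))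
    (fun x hx => mul_pos (Real.rpow_pos_of_pos (neg_pos.2 (hneg x hx)) _)
      (Real.rpow_pos_of_pos (hpos x hx) _))
    (fun x hx => by
      have h1 : HasDerivAt (fun x : ℝ => -x) (-1) x := hasDerivAt_neg x
      have h2 : HasDerivAt (fun x : ℝ => 1 - r * x) (-r) x := by
        simpa using ((hasDerivAt_id x).const_mul r).const_sub 1
      exact (h1.rpow_const (Or.inl (neg_pos.2 (hneg x hx)).ne')).mul
        (h2.rpow_const (Or.inl (hpos x hx).ne')))
    (fun x hx => by
      have hx0 := neg_pos.2 (hneg x hx)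
      have hx1 := hpos x hx
      rw [hR, hq, Real.rpow_sub_one hx0.ne', Real.rpow_sub_one hx1.ne', hA]
      have e1 := div_mul_cancel₀ ((-x) ^ a) hx0.ne'
      have e2 := div_mul_cancel₀ ((1 - r * x) ^ κ) hx1.ne'
      linear_combination (-a * (1 - r * x) ^ κ * ρ * (1 - r * x)) * e1 +
        ((-x) ^ a * r * κ * ρ * x) * e2 + ((-x) ^ a * (1 - r * x) ^ κ * r * ρ * x) * hκ)
  refine ⟨?_, P.haveForm one_pos hc hρ hH (fun x hx => ?_) fun x hx => ?_⟩
  · by_contra hcon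
    have ha0 : a ≤ 0 := by linarith
    refine P.false_of_tendsto hne hb hc (φ := fun x => c * (1 - r * x) ^ κ) ?_ ?_
    · have h1 : ContinuousAt (fun x : ℝ => c * (1 - r * x) ^ κ) 0 := by
        refine continuousAt_const.mul (ContinuousAt.rpow_const (by fun_prop) (Or.inl (by simp)))
      have h2 := h1.tendsto
      simp only [mul_zero, sub_zero, Real.one_rpow, mul_one] at h2
      exact h2.mono_left nhdsWithin_le_nhds
    · intro x hx1 hx0 hx
      rw [hH x hx]
      have h3 : 1 ≤ (-x) ^ a := Real.one_le_rpow_of_pos_of_le_one_of_nonpos (by linarith)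
        (by linarith) ha0
      have h4 := Real.rpow_pos_of_pos (hpos x hx) κ
      exact mul_le_mul_of_nonneg_left (le_mul_of_one_le_left h4.le h3) hc.le
  · have hx0 := neg_pos.2 (hneg x hx)
    have hx1 := hpos x hx
    rw [hR, show -(n : ℝ) - 1 - (a - 1) = κ - 1 by rw [hκ]; ring, Real.rpow_sub_one hx0.ne',
      Real.rpow_sub_one hx1.ne']
    have e1 := div_mul_cancel₀ ((-x) ^ a) hx0.ne'
    have e2 := div_mul_cancel₀ ((1 - r * x) ^ κ) hx1.ne'
    linear_combination (ρ * ((1 - r * x) ^ κ / (1 - r * x)) * (1 - r * x)) * e1 +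
      (ρ * (-x) ^ a) * e2
  · have hx0 := neg_pos.2 (hneg x hx)
    have hx1 := hpos x hx
    rw [mul_mul_mul_comm, ← Real.rpow_add hx0, ← Real.rpow_add hx1]
    congr 2
    · ring
    · rw [hκ]; ring

/-- A double root of `R` at the right endpoint gives an essential singularity there; `H b = 0` fixes
the sign in the exponential, and `l` becomes the scale of the change of variables. -/
theorem form_of_double_root (P : PearsonPair n f g H r₂ r₁ r₀ a₀) (hn : 2 ≤ n)
    (hne : ∃ x, 0 < f x) {b : ℝ} (hb : IsLUB {x | 0 < f x} b) {l : ℝ} (hr₂ : 0 < r₂)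
    (hR : ∀ x, r₂ * (x + b) ^ 2 + r₁ * (x + b) + r₀ = r₂ * x ^ 2)
    (hq : ∀ x, (n - 1) * r₂ * (x + b) + a₀ = (n - 1) * r₂ * x + r₂ * l)
    (hneg : ∀ x, 0 < f (x + b) → x < 0) :
    0 < l ∧ HaveForm f g l b {x | 0 < f (l * x + b)}
      (fun x => (-x) ^ (-(n : ℝ) - 1) * Real.exp (1 / x))
      (fun x => (-x) ^ (-2 * (n : ℝ)) * Real.exp (2 / x)) := by
  have hn' : (2 : ℝ) ≤ n := by exact_mod_cast hn
  set κ : ℝ := -(n : ℝ) + 1 with hκ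
  obtain ⟨c, hc, hH⟩ := P.exists_eq_const_mul hne (s := 1) (t := b) one_pos
    (E := fun x => (-x) ^ κ * Real.exp (l * x⁻¹))
    (E' := fun x => -1 * κ * (-x) ^ (κ - 1) * Real.exp (l * x⁻¹) +
      (-x) ^ κ * (Real.exp (l * x⁻¹) * (l * -(x ^ 2)⁻¹)))
    (fun x hx => mul_pos (Real.rpow_pos_of_pos (neg_pos.2 (hneg x (by simpa using hx))) _)
      (Real.exp_pos _))
    (fun x hx => by
      have hx0 := hneg x (by simpa using hx)
      have h1 : HasDerivAt (fun x : ℝ => -x) (-1) x := hasDerivAt_neg x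
      exact (h1.rpow_const (Or.inl (neg_pos.2 hx0).ne')).mul
        (((hasDerivAt_inv hx0.ne).const_mul l).exp))
    (fun x hx => by
      have hx0 := hneg x (by simpa using hx)
      have hx0' : x ≠ 0 := hx0.ne
      rw [one_mul, hR, hq, Real.rpow_sub_one (neg_pos.2 hx0).ne', hκ]
      field_simp
      ring)
  have hl : 0 < l := by
    by_contra hcon
    have hl0 : l ≤ 0 := not_lt.1 hcon
    refine P.false_of_tendsto hne hb hc (φ := fun _ => c) tendsto_const_nhds ?_
    intro x hx1 hx0 hx
    rw [hH x hx]
    have h3 : 1 ≤ (-x) ^ κ := Real.one_le_rpow_of_pos_of_le_one_of_nonpos (by linarith)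
        (by linarith) (by rw [hκ]; linarith)
    have h4 : 1 ≤ Real.exp (l * x⁻¹) :=
      Real.one_le_exp (mul_nonneg_of_nonpos_of_nonpos hl0 (inv_nonpos.2 hx0.le))
    exact le_mul_of_one_le_right hc.le (one_le_mul_of_one_le_of_one_le h3 h4)
  have hneg' : ∀ x, 0 < f (l * x + b) → x < 0 := fun x hx => by
    have := hneg _ hx
    by_contra h
    exact absurd (mul_nonneg hl.le (not_lt.1 h)) (not_le.2 this)
  refine ⟨hl, P.haveForm hl (E := fun x => (-x) ^ κ * Real.exp (1 / x))
    (c := c * l ^ κ) (ρ := r₂ * l ^ 2) (mul_pos hc (Real.rpow_pos_of_pos hl _)) (by positivity)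
    (fun x hx => ?_) (fun x hx => ?_) fun x hx => ?_⟩
  · have hx0 := hneg' x hx
    have h1 := hH (l * x) (by rwa [one_mul])
    rw [one_mul] at h1
    rw [h1, show -(l * x) = l * -x by ring, Real.mul_rpow hl.le (neg_pos.2 hx0).le, mul_inv,
      mul_inv_cancel_left₀ hl.ne', one_div]
    ring
  · have hx0 := hneg' x hx
    have hx0' : x ≠ 0 := hx0.ne
    rw [hR, show -(n : ℝ) - 1 = κ - 1 - 1 by rw [hκ]; ring,
      Real.rpow_sub_one (neg_pos.2 hx0).ne', Real.rpow_sub_one (neg_pos.2 hx0).ne']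
    field_simp
  · have hx0 := neg_pos.2 (hneg' x hx)
    rw [mul_mul_mul_comm, ← Real.rpow_add hx0, ← Real.exp_add]
    congr 2
    · rw [hκ]; ring
    · ring

/-! ### Unbounded support on the right -/

theorem mem_of_le (P : PearsonPair n f g H r₂ r₁ r₀ a₀) (hbdd : ¬ BddAbove {x | 0 < f x})
    {x y : ℝ} (hx : 0 < f x) (hxy : x ≤ y) : 0 < f y := by
  obtain ⟨z, hz, hyz⟩ := not_bddAbove_iff.1 hbdd y
  exact P.ordConnected.out hx hz ⟨hxy, hyz.le⟩

theorem eq_Ioi (P : PearsonPair n f g H r₂ r₁ r₀ a₀) (hne : ∃ x, 0 < f x)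
    (hbdd : ¬ BddAbove {x | 0 < f x}) (hbelow : BddBelow {x | 0 < f x}) :
    ∃ a, {x | 0 < f x} = Set.Ioi a := by
  refine ⟨sInf {x | 0 < f x}, Set.ext fun y => ⟨fun hy => ?_, fun hy => ?_⟩⟩
  · refine lt_of_le_of_ne (csInf_le hbelow hy) fun h => ?_
    obtain ⟨x, hxy, hx⟩ : ∃ x, x < y ∧ x ∈ {x | 0 < f x} :=
      ((eventually_mem_nhdsWithin (s := Set.Iio y)).and
        (mem_nhdsWithin_of_mem_nhds (P.isOpen.mem_nhds hy))).exists
    exact absurd (csInf_le hbelow hx) (by rw [h]; exact not_le.2 hxy)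
  · obtain ⟨x, hx, hxy⟩ := exists_lt_of_csInf_lt hne hy
    exact P.mem_of_le hbdd hx hxy.le

theorem sq_coeff_nonneg (P : PearsonPair n f g H r₂ r₁ r₀ a₀) (hne : ∃ x, 0 < f x)
    (hbdd : ¬ BddAbove {x | 0 < f x}) : 0 ≤ r₂ := by
  by_contra hcon
  have hr : 0 < -r₂ := by linarith
  obtain ⟨x, hx⟩ := hne
  set y := max x (max 1 ((|r₁| + |r₀|) / -r₂)) with hy
  have h1 : 1 ≤ y := (le_max_left _ _).trans (le_max_right _ _)
  have h2 : (|r₁| + |r₀|) / -r₂ ≤ y := (le_max_right _ _).trans (le_max_right _ _)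
  rw [div_le_iff₀ hr] at h2
  have hxy : x ≤ y := le_max_left _ _
  have h3 := P.quadratic_pos (P.mem_of_le hbdd hx hxy)
  have h4 : r₁ * y ≤ |r₁| * y := mul_le_mul_of_nonneg_right (le_abs_self _) (by linarith)
  have h5 : r₀ ≤ |r₀| * y :=
    (le_abs_self _).trans (le_mul_of_one_le_right (abs_nonneg _) h1)
  nlinarith

theorem lin_coeff_nonneg (P : PearsonPair n f g H 0 r₁ r₀ a₀) (hne : ∃ x, 0 < f x)
    (hbdd : ¬ BddAbove {x | 0 < f x}) : 0 ≤ r₁ := by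
  by_contra hcon
  have hr : 0 < -r₁ := by linarith
  obtain ⟨x, hx⟩ := hne
  set y := max x (r₀ / -r₁) with hy
  have h2 : r₀ / -r₁ ≤ y := le_max_right _ _
  rw [div_le_iff₀ hr] at h2
  have hxy : x ≤ y := le_max_left _ _
  have h3 := P.quadratic_pos (P.mem_of_le hbdd hx hxy)
  linarith

/-- With an infinite right endpoint and `r₂ > 0`, `H` would be comparable to `y ^ (-(n - 1))`,
contradicting its decay: `H y ^ (n - 1) exp (-M / y)` is eventually increasing. -/
theorem sq_coeff_eq_zero (P : PearsonPair n f g H r₂ r₁ r₀ a₀) (hn : 2 ≤ n) (hne : ∃ x, 0 < f x)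
    (hbdd : ¬ BddAbove {x | 0 < f x}) : r₂ = 0 := by
  by_contra hcon
  have hr : 0 < r₂ := lt_of_le_of_ne (P.sq_coeff_nonneg hne hbdd) (Ne.symm hcon)
  obtain ⟨m, rfl⟩ : ∃ m, n = m + 2 := ⟨n - 2, by omega⟩
  have hcast : (((m + 2 : ℕ) : ℝ) - 1) = m + 1 := by push_cast; ring
  obtain ⟨x, hx⟩ := hne
  set D : ℝ := |(m + 1) * r₁ - a₀| + |(m + 1) * r₀| with hD
  set M : ℝ := 2 * D / r₂ with hM
  set Y := max x (max 1 (2 * (|r₁| + |r₀|) / r₂)) with hY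
  have hY1 : 1 ≤ Y := (le_max_left _ _).trans (le_max_right _ _)
  have hfY : ∀ y, Y ≤ y → 0 < f y := fun y hy =>
    P.mem_of_le hbdd hx ((le_max_left x _).trans hy)
  have hRlow : ∀ y, Y ≤ y → r₂ * y ^ 2 / 2 ≤ r₂ * y ^ 2 + r₁ * y + r₀ := by
    intro y hy
    have h1 : 1 ≤ y := hY1.trans hy
    have h2 : 2 * (|r₁| + |r₀|) / r₂ ≤ y := ((le_max_right _ _).trans (le_max_right _ _)).trans hy
    rw [div_le_iff₀ hr] at h2
    have h4 : -(|r₁| * y) ≤ r₁ * y := by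
      rw [← neg_mul]; exact mul_le_mul_of_nonneg_right (neg_abs_le _) (by linarith)
    have h5 : -(|r₀| * y) ≤ r₀ :=
      (neg_le_neg (le_mul_of_one_le_right (abs_nonneg _) h1)).trans (neg_abs_le _)
    have h6 := mul_le_mul_of_nonneg_right h2 (show 0 ≤ y by linarith)
    nlinarith
  have hmono : MonotoneOn (fun y => H y * y ^ (m + 1) * Real.exp (-M * y⁻¹)) (Set.Ici Y) := by
    refine monotoneOn_of_hasDerivWithinAt_nonneg (convex_Ici _) ?_
      (f' := fun y => (-(((((m + 2 : ℕ) : ℝ) - 1) * r₂ * y + a₀) * f y) * y ^ (m + 1) +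
        H y * ((m + 1 : ℕ) * y ^ m)) * Real.exp (-M * y⁻¹) +
        H y * y ^ (m + 1) * (Real.exp (-M * y⁻¹) * (-M * -(y ^ 2)⁻¹)))
      (fun y hy => ?_) fun y hy => ?_
    · refine (P.continuous.mul (continuous_pow _)).continuousOn.mul
        (Real.continuous_exp.comp_continuousOn (continuousOn_const.mul
          (continuousOn_id.inv₀ fun y hy => ?_)))
      have : Y ≤ y := hy
      exact ne_of_gt (show 0 < y by linarith)
    · rw [interior_Ici] at hy
      have hy : Y < y := hy
      have hy0 : y ≠ 0 := ne_of_gt (by linarith)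
      have h1 := P.hasDerivAt y (hfY y hy.le)
      have h2 := hasDerivAt_pow (m + 1) y
      have h3 := ((hasDerivAt_inv hy0).const_mul (-M)).exp
      exact ((h1.mul h2).mul h3).hasDerivWithinAt
    · rw [interior_Ici] at hy
      have hy : Y < y := hy
      have hy0 : 0 < y := by linarith
      have hy1 : 1 ≤ y := by linarith
      have hfy := hfY y hy.le
      have hlow := hRlow y hy.le
      rw [← P.mul_eq y hfy, hcast]
      set R := r₂ * y ^ 2 + r₁ * y + r₀ with hR
      have hMR : D * y ^ 2 ≤ M * R := by
        have h0 : 0 ≤ M := div_nonneg (by positivity) hr.le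
        calc D * y ^ 2 = M * (r₂ * y ^ 2 / 2) := by rw [hM]; field_simp
          _ ≤ M * R := mul_le_mul_of_nonneg_left hlow h0
      have h1 : -(|(m + 1) * r₁ - a₀| * y ^ 2) ≤ ((m + 1) * r₁ - a₀) * y ^ 2 := by
        rw [← neg_mul]; exact mul_le_mul_of_nonneg_right (neg_abs_le _) (by positivity)
      have h2 : -(|(m + 1) * r₀| * y ^ 2) ≤ (m + 1) * r₀ * y := by
        have h3 : -(|(m + 1) * r₀| * y) ≤ (m + 1) * r₀ * y := by
          rw [← neg_mul]; exact mul_le_mul_of_nonneg_right (neg_abs_le _) hy0.le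
        refine le_trans (neg_le_neg (mul_le_mul_of_nonneg_left ?_ (abs_nonneg _))) h3
        nlinarith
      have h4 : 0 ≤ -((m + 1) * r₂ * y + a₀) * y ^ 2 + (m + 1) * y * R + M * R := by
        have : -((m + 1) * r₂ * y + a₀) * y ^ 2 + (m + 1) * y * R =
            ((m + 1) * r₁ - a₀) * y ^ 2 + (m + 1) * r₀ * y := by rw [hR]; ring
        rw [this]
        have h5 : D * y ^ 2 = |(m + 1) * r₁ - a₀| * y ^ 2 + |(m + 1) * r₀| * y ^ 2 := by
          rw [hD]; ring
        linarith
      have h5 : 0 ≤ f y * y ^ m * Real.exp (-M * y⁻¹) / y *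
          (-((m + 1) * r₂ * y + a₀) * y ^ 2 + (m + 1) * y * R + M * R) :=
        mul_nonneg (by positivity) h4
      refine h5.trans_eq ?_
      push_cast
      field_simp
      ring
  have hp : ((Polynomial.X : Polynomial ℝ) ^ (m + 1)).degree < ((m + 2 : ℕ) : WithBot ℕ) := by
    rw [Polynomial.degree_X_pow]; exact_mod_cast Nat.lt_succ_self (m + 1)
  have hlim := P.tendsto hbdd _ hp
  simp only [Polynomial.eval_pow, Polynomial.eval_X] at hlim
  have hM0 : 0 ≤ M := div_nonneg (by positivity) hr.le
  have hge : ∀ᶠ y in atTop, H Y * Y ^ (m + 1) * Real.exp (-M * Y⁻¹) ≤ H y * y ^ (m + 1) := by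
    filter_upwards [eventually_ge_atTop Y] with y hy
    refine (hmono (Set.mem_Ici.2 le_rfl) hy hy).trans (mul_le_of_le_one_right ?_ ?_)
    · exact mul_nonneg (P.pos y (hfY y hy)).le (pow_nonneg (by linarith) _)
    · rw [Real.exp_le_one_iff]
      have : 0 ≤ y⁻¹ := inv_nonneg.2 (by linarith)
      nlinarith
  have h0 := ge_of_tendsto hlim hge
  exact absurd h0 (not_le.2 (mul_pos (mul_pos (P.pos Y (hfY Y le_rfl))
    (pow_pos (by linarith) _)) (Real.exp_pos _)))

/-- A linear `R` gives a power weight with an infinite right endpoint; the bound on the exponent is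
the decay of `H` against `(y + r₀ / r₁) ^ (n - 1)`. -/
theorem form_of_linear (P : PearsonPair n f g H 0 r₁ r₀ a₀) (hn : 2 ≤ n) (hne : ∃ x, 0 < f x)
    (hbdd : ¬ BddAbove {x | 0 < f x}) (hr₁ : 0 < r₁) :
    BddBelow {x | 0 < f x} ∧ -(a₀ / r₁) - 1 < -(n : ℝ) ∧
      (∀ x, 0 < f (1 * x + (1 - r₀ / r₁)) → 0 < 1 - (-1) * x) ∧
      HaveForm f g 1 (1 - r₀ / r₁) {x | 0 < f (1 * x + (1 - r₀ / r₁))}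
        (fun x => (1 - (-1) * x) ^ (-(a₀ / r₁) - 1))
        (fun x => (1 - (-1) * x) ^ (2 * (-(a₀ / r₁) - 1) + 1)) := by
  set t := 1 - r₀ / r₁ with ht
  set μ := a₀ / r₁ with hμ
  have ha : a₀ = μ * r₁ := by rw [hμ, div_mul_cancel₀ _ hr₁.ne']
  have hR : ∀ x : ℝ, 0 * (1 * x + t) ^ 2 + r₁ * (1 * x + t) + r₀ = r₁ * (1 - (-1) * x) := by
    intro x; rw [ht]; field_simp; ring
  have hpos : ∀ x, 0 < f (1 * x + t) → 0 < 1 - (-1) * x := fun x hx => by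
    have h := P.quadratic_pos hx
    rw [hR] at h
    exact pos_of_mul_pos_right h hr₁.le
  obtain ⟨c, hc, hH⟩ := P.exists_eq_const_mul hne (s := 1) (t := t) one_pos
    (E := fun x => (1 - (-1) * x) ^ (-μ))
    (E' := fun x => 1 * -μ * (1 - (-1) * x) ^ (-μ - 1))
    (fun x hx => Real.rpow_pos_of_pos (hpos x hx) _)
    (fun x hx => by
      have h2 : HasDerivAt (fun x : ℝ => 1 - (-1) * x) 1 x := by
        simpa using ((hasDerivAt_id x).const_mul (-1 : ℝ)).const_sub 1
      exact h2.rpow_const (Or.inl (hpos x hx).ne'))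
    (fun x hx => by
      have hx1 := hpos x hx
      rw [hR, Real.rpow_sub_one hx1.ne', ha]
      have e := div_mul_cancel₀ ((1 - (-1) * x) ^ (-μ)) hx1.ne'
      linear_combination (-μ * r₁) * e)
  refine ⟨⟨-(r₀ / r₁), fun y hy => ?_⟩, ?_, hpos, P.haveForm one_pos hc hr₁ hH (fun x hx => ?_)
    fun x hx => ?_⟩
  · have h := hpos (y - t) (by rwa [one_mul, sub_add_cancel])
    rw [ht] at h
    linarith
  · by_contra hcon
    have hμn : 0 ≤ -μ + ((n - 1 : ℕ) : ℝ) := by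
      rw [Nat.cast_sub (by omega)]; push_cast; linarith
    have hp : (((Polynomial.X : Polynomial ℝ) + Polynomial.C (r₀ / r₁)) ^ (n - 1)).degree <
        (n : WithBot ℕ) := by
      rw [Polynomial.degree_pow, Polynomial.degree_X_add_C, nsmul_eq_mul, mul_one]
      exact_mod_cast (by omega : n - 1 < n)
    have hlim := P.tendsto hbdd _ hp
    obtain ⟨x₀, hx₀⟩ := hne
    have hge : ∀ᶠ y in atTop, c ≤
        H y * ((Polynomial.X + Polynomial.C (r₀ / r₁)) ^ (n - 1) : Polynomial ℝ).eval y := by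
      filter_upwards [eventually_ge_atTop x₀, eventually_ge_atTop t] with y hy hyt
      have h1 := hH (y - t) (by rw [one_mul, sub_add_cancel]; exact P.mem_of_le hbdd hx₀ hy)
      rw [one_mul, sub_add_cancel] at h1
      have h2 : y + r₀ / r₁ = 1 - (-1) * (y - t) := by rw [ht]; ring
      have h3 : 1 ≤ 1 - (-1) * (y - t) := by linarith
      simp only [Polynomial.eval_pow, Polynomial.eval_add, Polynomial.eval_X, Polynomial.eval_C]
      rw [h1, h2, ← Real.rpow_natCast, mul_assoc, ← Real.rpow_add (by linarith)]
      exact le_mul_of_one_le_right hc.le (Real.one_le_rpow h3 hμn)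
    exact absurd (ge_of_tendsto hlim hge) (not_le.2 hc)
  · have hx1 := (hpos x hx).ne'
    rw [hR, Real.rpow_sub_one hx1]
    have e := div_mul_cancel₀ ((1 - (-1) * x) ^ (-μ)) hx1
    linear_combination r₁ * e
  · rw [← Real.rpow_add (hpos x hx)]
    congr 1
    ring

/-- A constant `R` gives the exponential weight, whose support is bounded below by integrability. -/
theorem form_of_constant (P : PearsonPair n f g H 0 0 r₀ a₀) (hn : 2 ≤ n) (hne : ∃ x, 0 < f x)
    (hbdd : ¬ BddAbove {x | 0 < f x}) :
    BddBelow {x | 0 < f x} ∧ ∃ s, 0 < s ∧ HaveForm f g s 0 {x | 0 < f (s * x + 0)}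
        (fun x => Real.exp (-x)) (fun x => Real.exp (-2 * x)) := by
  have hr₀ : 0 < r₀ := by
    obtain ⟨x, hx⟩ := hne
    simpa using P.quadratic_pos hx
  set l := a₀ / r₀ with hl
  have ha : a₀ = l * r₀ := by rw [hl, div_mul_cancel₀ _ hr₀.ne']
  obtain ⟨c, hc, hH⟩ := P.exists_eq_const_mul hne (s := 1) (t := 0) one_pos
    (E := fun x => Real.exp (-l * x)) (E' := fun x => Real.exp (-l * x) * -l)
    (fun x _ => Real.exp_pos _)
    (fun x hx => by simpa using ((hasDerivAt_id x).const_mul (-l)).exp)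
    (fun x hx => by rw [ha]; ring)
  simp only [one_mul, add_zero] at hH
  obtain ⟨x₀, hx₀⟩ := hne
  have hl0 : 0 < l := by
    by_contra hcon
    have h1deg : (1 : Polynomial ℝ).degree < (n : WithBot ℕ) := by
      rw [Polynomial.degree_one]; exact_mod_cast (by omega : 0 < n)
    have hlim := P.tendsto hbdd 1 h1deg
    have hge : ∀ᶠ y in atTop, c ≤ H y * (1 : Polynomial ℝ).eval y := by
      filter_upwards [eventually_ge_atTop x₀, eventually_ge_atTop 0] with y hy hy0
      rw [hH y (P.mem_of_le hbdd hx₀ hy), Polynomial.eval_one, mul_one]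
      exact le_mul_of_one_le_right hc.le (Real.one_le_exp (mul_nonneg (by linarith) hy0))
    exact absurd (ge_of_tendsto hlim hge) (not_le.2 hc)
  constructor
  · -- otherwise the exponential weight would be integrable on the whole line
    by_contra hbelow
    have hall : ∀ y, 0 < f y := fun y => by
      obtain ⟨z, hz, hzy⟩ := not_bddBelow_iff.1 hbelow y
      exact P.mem_of_le hbdd hz hzy.le
    have hle : ∀ y ∈ Set.Iic (0 : ℝ), c / r₀ ≤ f y := by
      intro y hy
      have h1 := P.mul_eq y (hall y)
      rw [hH y (hall y)] at h1
      rw [div_le_iff₀ hr₀]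
      have h2 : 1 ≤ Real.exp (-l * y) :=
        Real.one_le_exp (by rw [neg_mul_comm]; exact mul_nonneg hl0.le (neg_nonneg.2 hy))
      have h3 := le_mul_of_one_le_right hc.le h2
      linarith
    have hint : IntegrableOn (fun _ : ℝ => c / r₀) (Set.Iic 0) := by
      refine Integrable.mono' P.integrable.integrableOn aestronglyMeasurable_const ?_
      filter_upwards [ae_restrict_mem measurableSet_Iic] with y hy
      rw [Real.norm_of_nonneg (div_pos hc hr₀).le]
      exact hle y hy
    rw [integrableOn_const_iff] at hint
    simp [(div_pos hc hr₀).ne'] at hint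
  · refine ⟨l⁻¹, inv_pos.2 hl0, P.haveForm (inv_pos.2 hl0) hc hr₀ (E := fun x => Real.exp (-x))
      (fun x hx => ?_) (fun x _ => by ring) fun x _ => ?_⟩
    · rw [hH _ hx]
      congr 2
      field_simp
      ring
    · rw [← Real.exp_add]
      congr 1
      ring

end PearsonPair

/-! ### Classification of the weights -/

namespace PearsonPair

variable {n : ℕ} {f g H : ℝ → ℝ} {r₂ r₁ r₀ a₀ : ℝ}

theorem forms_of_bddAbove (P : PearsonPair n f g H r₂ r₁ r₀ a₀) (hn : 2 ≤ n)
    (hne : ∃ x, 0 < f x) (hbdd : BddAbove {x | 0 < f x}) :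
    ∃ s t : ℝ, 0 < s ∧ IsLUB {x | 0 < f x} t ∧
      ((∃ α r : ℝ, -1 < α ∧ (∀ x ∈ {x | 0 < f (s * x + t)}, r * x ≠ 1) ∧
          HaveForm f g s t {x | 0 < f (s * x + t)}
            (fun x => (-x) ^ α * (1 - r * x) ^ (-(n : ℝ) - 1 - α))
            (fun x => (-x) ^ (2 * α + 1) * (1 - r * x) ^ (-2 * (n : ℝ) - 1 - 2 * α))) ∨
        HaveForm f g s t {x | 0 < f (s * x + t)}
          (fun x => (-x) ^ (-(n : ℝ) - 1) * Real.exp (1 / x))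
          (fun x => (-x) ^ (-2 * (n : ℝ)) * Real.exp (2 / x))) := by
  obtain ⟨b, hb⟩ : ∃ b, IsLUB {x | 0 < f x} b := ⟨_, isLUB_csSup hne hbdd⟩
  have hRb := P.quadratic_eq_zero hne hb
  set ρ₁ := 2 * r₂ * b + r₁ with hρ₁
  have hR : ∀ x, r₂ * (x + b) ^ 2 + r₁ * (x + b) + r₀ = x * (r₂ * x + ρ₁) := fun x => by
    rw [hρ₁]; linear_combination hRb
  have hneg : ∀ x, 0 < f (x + b) → x < 0 := fun x hx => by
    have h1 : x + b ≤ b := hb.1 hx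
    refine lt_of_le_of_ne (by linarith) fun h => ?_
    have h2 := P.pos _ hx
    rw [h, zero_add, P.eq_zero b fun y hy => hb.1 hy] at h2
    exact lt_irrefl _ h2
  have hfac : ∀ x, 0 < f (x + b) → r₂ * x + ρ₁ < 0 := fun x hx => by
    have h1 := P.quadratic_pos hx
    rw [hR] at h1
    by_contra h
    exact absurd (mul_nonpos_of_nonpos_of_nonneg (hneg x hx).le (not_lt.1 h)) (not_le.2 h1)
  have hρ₁_le : ρ₁ ≤ 0 := by
    by_contra hcon
    have hcon : 0 < ρ₁ := not_le.1 hcon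
    have hd : 0 < ρ₁ / (|r₂| + 1) := by positivity
    obtain ⟨z, hz, hzb⟩ := (lt_isLUB_iff hb).1 (show b - ρ₁ / (|r₂| + 1) < b by linarith)
    have hz' : 0 < f (z - b + b) := by rw [sub_add_cancel]; exact hz
    have h1 := hfac _ hz'
    have h2 := hneg _ hz'
    have h3 : -(z - b) * (|r₂| + 1) < ρ₁ := by
      rw [← lt_div_iff₀ (by positivity)]; linarith
    have h4 : r₂ * -(z - b) ≤ |r₂| * -(z - b) :=
      mul_le_mul_of_nonneg_right (le_abs_self _) (by linarith)
    linarith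
  set A := (n - 1) * r₂ * b + a₀ with hA
  rcases lt_or_eq_of_le hρ₁_le with hlt | heq
  · have hρ : 0 < -ρ₁ := by linarith
    set r := r₂ / -ρ₁ with hr
    have hrρ : r * -ρ₁ = r₂ := div_mul_cancel₀ _ hρ.ne'
    have hR' : ∀ x, r₂ * (1 * x + b) ^ 2 + r₁ * (1 * x + b) + r₀ = -ρ₁ * -x * (1 - r * x) :=
      fun x => by rw [one_mul, hR]; linear_combination (-x ^ 2) * hrρ
    have hpos : ∀ x, 0 < f (1 * x + b) → 0 < 1 - r * x := fun x hx => by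
      have h1 := P.quadratic_pos hx
      rw [hR'] at h1
      have h2 := hneg x (by rwa [one_mul] at hx)
      exact pos_of_mul_pos_right h1 (mul_pos hρ (neg_pos.2 h2)).le
    obtain ⟨hα, hform⟩ := P.form_of_simple_root hne hb (r := r) (A := A) hρ hR'
      (fun x => by rw [hA]; linear_combination (-(n - 1) * x) * hrρ)
      (fun x hx => hneg x (by rwa [one_mul] at hx)) hpos
    refine ⟨1, b, one_pos, hb, Or.inl ⟨A / -ρ₁ - 1, r, hα, fun x hx h => ?_, hform⟩⟩
    have := hpos x hx
    rw [h] at this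
    exact absurd this (by norm_num)
  · have hr₂ : 0 < r₂ := by
      obtain ⟨y, hy⟩ := hne
      have hy' : 0 < f (y - b + b) := by rwa [sub_add_cancel]
      have h1 := hfac _ hy'
      have h2 := hneg _ hy'
      rw [heq, add_zero] at h1
      by_contra h
      exact absurd (mul_nonneg_of_nonpos_of_nonpos (not_lt.1 h) h2.le) (not_le.2 h1)
    obtain ⟨hl, hform⟩ := P.form_of_double_root hn hne hb (l := A / r₂) hr₂
      (fun x => by rw [hR, heq]; ring)
      (fun x => by rw [mul_div_cancel₀ _ hr₂.ne', hA]; ring) hneg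
    exact ⟨_, b, hl, hb, Or.inr hform⟩

theorem forms_of_not_bddAbove (P : PearsonPair n f g H r₂ r₁ r₀ a₀) (hn : 2 ≤ n)
    (hne : ∃ x, 0 < f x) (hbdd : ¬ BddAbove {x | 0 < f x}) :
    ∃ s t a : ℝ, 0 < s ∧ {x | 0 < f x} = Set.Ioi a ∧
      ((∃ α r : ℝ, α < -(n : ℝ) ∧ r < 0 ∧ (∀ x ∈ {x | 0 < f (s * x + t)}, 0 < 1 - r * x) ∧
          HaveForm f g s t {x | 0 < f (s * x + t)}
            (fun x => (1 - r * x) ^ α) (fun x => (1 - r * x) ^ (2 * α + 1))) ∨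
        HaveForm f g s t {x | 0 < f (s * x + t)}
          (fun x => Real.exp (-x)) (fun x => Real.exp (-2 * x))) := by
  obtain rfl := P.sq_coeff_eq_zero hn hne hbdd
  rcases lt_or_eq_of_le (P.lin_coeff_nonneg hne hbdd) with hlt | rfl
  · obtain ⟨hbelow, hα, hpos, hform⟩ := P.form_of_linear hn hne hbdd hlt
    obtain ⟨a, ha⟩ := P.eq_Ioi hne hbdd hbelow
    exact ⟨1, _, a, one_pos, ha, Or.inl ⟨_, -1, hα, by norm_num, hpos, hform⟩⟩
  · obtain ⟨hbelow, s, hs, hform⟩ := P.form_of_constant hn hne hbdd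
    obtain ⟨a, ha⟩ := P.eq_Ioi hne hbdd hbelow
    exact ⟨s, 0, a, hs, ha, Or.inr hform⟩

end PearsonPair

theorem measurable_of_continuousOn_of_eq_zero {f : ℝ → ℝ} {I : Set ℝ} (hI : IsOpen I)
    (hf : ContinuousOn f I) (hz : ∀ x, x ∉ I → f x = 0) : Measurable f := by
  refine measurable_of_restrict_of_restrict_compl hI.measurableSet
    (continuousOn_iff_continuous_domRestrict.1 hf).measurable ?_
  have : Iᶜ.domRestrict f = fun _ => 0 := funext fun x => hz x x.2
  rw [this]
  exact measurable_const

end Decimation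

theorem mainTheorem5 (n : ℕ) (hn : 2 ≤ n) (f g : ℝ → ℝ) (I : Set ℝ)
    (hIopen : IsOpen I) (hIconn : I.OrdConnected)
    (hf_nonneg : ∀ x, 0 ≤ f x) (hf_diff : DifferentiableOn ℝ f I) (hf_zero : ∀ x, x ∉ I → f x = 0)
    (hg_nonneg : ∀ x, 0 ≤ g x) (hg_meas : Measurable g)
    (hf_prob : IsProbabilityMeasure (Decimation.OE n f))
    (h : Decimation.evenLaw (Decimation.superpose (Decimation.OE n f) (Decimation.OE n f)) =
      Decimation.orderedLaw (Decimation.UE n g)) :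
    {x | 0 < f x} ≠ Set.univ ∧
    ∃ (s t : ℝ) (K : Set ℝ), 0 < s ∧ K = {x | 0 < f (s * x + t)} ∧
      ((IsOpen K ∧ K.OrdConnected ∧ IsLUB K 0 ∧
          ((∃ α r : ℝ, -1 < α ∧ (∀ x ∈ K, r * x ≠ 1) ∧
              Decimation.HaveForm f g s t K
                (fun x => (-x) ^ α * (1 - r * x) ^ (-(n : ℝ) - 1 - α))
                (fun x => (-x) ^ (2 * α + 1) * (1 - r * x) ^ (-2 * (n : ℝ) - 1 - 2 * α))) ∨
            Decimation.HaveForm f g s t K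
              (fun x => (-x) ^ (-(n : ℝ) - 1) * Real.exp (1 / x))
              (fun x => (-x) ^ (-2 * (n : ℝ)) * Real.exp (2 / x)))) ∨
        (∃ a : ℝ, K = Set.Ioi a ∧
          ((∃ α r : ℝ, α < -(n : ℝ) ∧ r < 0 ∧ (∀ x ∈ K, 0 < 1 - r * x) ∧
              Decimation.HaveForm f g s t K
                (fun x => (1 - r * x) ^ α)
                (fun x => (1 - r * x) ^ (2 * α + 1))) ∨
            Decimation.HaveForm f g s t K
              (fun x => Real.exp (-x))
              (fun x => Real.exp (-2 * x))))) := by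
  have hn0 : n ≠ 0 := by omega
  have hfc := hf_diff.continuousOn
  have hfm := Decimation.measurable_of_continuousOn_of_eq_zero hIopen hfc hf_zero
  have hfZ := Decimation.mass_ne_of_isProbabilityMeasure (β := 1) hf_prob
  have hg_prob : IsProbabilityMeasure (Decimation.UE n g) := by
    have h1 : IsProbabilityMeasure
        (Decimation.superpose (Decimation.OE n f) (Decimation.OE n f)) :=
      Measure.isProbabilityMeasure_map Decimation.measurable_append.aemeasurable
    have h2 : IsProbabilityMeasure ((Decimation.UE n g).map Decimation.decr) := by
      rw [← Decimation.orderedLaw, ← h]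
      exact Measure.isProbabilityMeasure_map Decimation.measurable_evenPart.aemeasurable
    exact Measure.isProbabilityMeasure_of_map Decimation.decr
  have hgZ := Decimation.mass_ne_of_isProbabilityMeasure (β := 2) hg_prob
  have hint : ∀ q : Polynomial ℝ, q.degree < (n : ℕ) → Integrable fun z => q.eval z * f z :=
    fun q hq => Decimation.integrable_eval_mul hf_nonneg hfm hfZ.2 hfZ.1 hq
  have hne : ∃ x, 0 < f x := by
    by_contra hcon
    have h0 : ∀ x, f x = 0 := fun x =>
      le_antisymm (not_lt.1 fun hx => hcon ⟨x, hx⟩) (hf_nonneg x)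
    refine hfZ.1 ?_
    simp [Decimation.dens, h0, hn0]
  obtain ⟨C, hC, hdet⟩ := Decimation.exists_det_tailMatrix_eq hn0 hf_nonneg hfm hg_nonneg hg_meas
    hint hfZ hgZ h
  obtain ⟨hpq, hqp⟩ := Decimation.tail_relation hint hg_meas hgZ.1 hC hdet
  obtain ⟨H, r₂, r₁, r₀, a₀, P⟩ := Decimation.exists_pearsonPair hn hIopen hIconn hf_nonneg hfc
    hf_zero hg_nonneg hne hint hpq hqp
  by_cases hbdd : BddAbove {x | 0 < f x}
  · obtain ⟨s, t, hs, hlub, hform⟩ := P.forms_of_bddAbove hn hne hbdd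
    refine ⟨fun huniv => not_bddAbove_univ (huniv ▸ hbdd), s, t, _, hs, rfl, Or.inl
      ⟨Decimation.isOpen_affine_preimage P.isOpen,
        Decimation.ordConnected_affine_preimage hs P.ordConnected,
        Decimation.isLUB_affine_preimage hs hlub, hform⟩⟩
  · obtain ⟨s, t, a, hs, ha, hform⟩ := P.forms_of_not_bddAbove hn hne hbdd
    refine ⟨fun huniv => not_bddBelow_univ (α := ℝ) ?_, s, t, _, hs, rfl, Or.inr
      ⟨_, Decimation.affine_preimage_eq_Ioi hs ha, hform⟩⟩
    rw [← huniv, ha]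
    exact bddBelow_Ioi
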